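/- Let $n\ge 0$ and let $f_1,\dots,f_n$ be Bernstein functions $$f_j(x)=b_jx+\int_{(0,\infty)}(1-e^{-xs})\,m_j(ds),\qquad x\ge 0,$$ with $b_j\ge 0$ and $m_j$ a measure on $(0,\infty)$ with $\int\min(1,s)\,m_j(ds)<\infty$. Let $\lambda>0$ and $\nu\in(0,1)$. On a probability space let $N$ be a homogeneous Poisson process of rate $\lambda$, let $H^{f_1},\dots,H^{f_n}$ be subordinators with $\mathbb{E}e^{-\mu H^{f_j}(t)}=e^{-tf_j(\mu)}$ for $\mu,t\ge 0$, and let $H^\nu$ be a $\nu$-stable subordinator, $\mathbb{E}e^{-\mu H^\nu(t)}=e^{-t\mu^\nu}$, all of these processes being independent. Let $L^\nu(t)=\inf\{s\ge 0: H^\nu(s)\ge t\}$ be the inverse of $H^\nu$, and put $$X(t)=N\Big(\sum_{j=1}^n H^{f_j}(L^\nu(t))\Big),\qquad p_k(t)=P\{X(t)=k\},\qquad t\ge 0,\ k=0,1,2,\dots$$ For a sequence $(q_k)_{k\ge0}$ let $(Bq)_k=q_{k-1}$ with $q_{-1}=0$, and let $$f_j(\lambda(I-B))q_k=b_j\lambda(q_k-q_{k-1})+\int_{(0,\infty)}\Big(q_k-e^{-\lambda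 s}\sum_{m=0}^k\frac{(\lambda s)^m}{m!}q_{k-m}\Big)m_j(ds).$$ For a function $g$ that is continuous on $[0,\infty)$ and differentiable on $(0,\infty)$, let $$\frac{d^\nu}{dt^\nu}g(t)=\frac{1}{\Gamma(1-\nu)}\int_0^t(t-s)^{-\nu}g'(s)\,ds,\qquad t>0,$$ be its Dzerbayshan–Caputo derivative, which is said to exist at $t$ if the integral converges absolutely. Then $X(t)$ is (almost everywhere equal to) a random variable for every $t\ge 0$, and the following hold. 1. $(p_k)_{k\ge0}$ is a solution of the Cauchy problem $$\frac{d^\nu}{dt^\nu}p_k(t)=-\sum_{j=1}^n f_j(\lambda(I-B))p_k(t)\quad(t>0,\ k\ge 0),\qquad p_k(0)=\begin{cases}1,&k=0,\\0,&k>0,\end{cases}$$ where in particular the Caputo derivatives exist. It is the only one: every family $(q_k)_{k\ge0}$ of functions that are continuous on $[0,\infty)$ and differentiable on $(0,\infty)$, whose Caputo derivatives exist for all $t>0$, and which solves this problem, satisfies $q_k(t)=p_k(t)$ for all $k\ge0$ and $t\ge 0$. 2. For all $t\ge 0$ and all real $u$ with $|u|\le 1$, $$\mathbb{E}\,u^{X(t)}=E_{\nu,1}\Big(-t^\nu\sum_{j=1}^n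 f_j(\lambda(1-u))\Big),\qquad E_{\nu,1}(x)=\sum_{m=0}^\infty\frac{x^m}{\Gamma(\nu m+1)}.$$ -/

import Mathlib

open MeasureTheory ProbabilityTheory Set
open scoped NNReal

noncomputable section

/-- A Bernstein function without killing term, given by its drift `b ≥ 0` and its Lévy measure `m`,
a measure on `(0, ∞)` with `∫ min(1, s) m(ds) < ∞`. -/
structure BernsteinFn where
  drift : ℝ≥0
  levy : Measure ℝ
  levy_Iic : levy (Iic 0) = 0
  lintegral_min_lt_top : ∫⁻ s, ENNReal.ofReal (min 1 s) ∂levy < ⊤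

/-- The values `f(x) = b x + ∫ (1 - e^{-x s}) m(ds)` (used for `x ≥ 0`). -/
def BernsteinFn.eval (f : BernsteinFn) (x : ℝ) : ℝ :=
  f.drift * x + ∫ s, (1 - Real.exp (-(x * s))) ∂f.levy

/-- The backward shift `(B p)_k = p_{k-1}`, with `p_{-1} = 0`. -/
def backShift (p : ℕ → ℝ) : ℕ → ℝ
  | 0 => 0
  | k + 1 => p k

/-- The semigroup `e^{-s lam (I - B)} = e^{-s lam} ∑_m (s lam)^m / m! B^m`. As `(B^m p)_k = 0` for
`m > k`, only the terms `m ≤ k` contribute to the `k`-th entry. -/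
def expShift (lam s : ℝ) (p : ℕ → ℝ) (k : ℕ) : ℝ :=
  Real.exp (-(s * lam)) *
    ∑ m ∈ Finset.range (k + 1), (s * lam) ^ m / (m.factorial : ℝ) * (backShift^[m] p) k

/-- The operator `f(lam (I - B)) = b lam (I - B) + ∫ (I - e^{-s lam (I - B)}) m(ds)`. -/
def BernsteinFn.shiftOp (f : BernsteinFn) (lam : ℝ) (p : ℕ → ℝ) (k : ℕ) : ℝ :=
  f.drift * (lam * (p k - backShift p k)) + ∫ s, (p k - expShift lam s p k) ∂f.levy

/-- The Mittag-Leffler function `E_{a,b}(x) = ∑_m x^m / Γ(a m + b)`. -/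
def mittagLeffler (a b x : ℝ) : ℝ :=
  ∑' m : ℕ, x ^ m / Real.Gamma (a * m + b)

/-- The Dzerbayshan-Caputo derivative of order `ν ∈ (0,1)` of `g` at `t > 0` exists and equals `c`:
`1/Γ(1-ν) ∫_0^t (t-s)^{-ν} g'(s) ds = c`. Here `g` is continuous on `[0,t]`, differentiable
on `(0,t)`, and the integral converges absolutely; in particular `g'` is integrable on `(0,t)` and
`g` is absolutely continuous on `[0,t]`. -/
structure HasCaputoDerivAt (ν : ℝ) (g : ℝ → ℝ) (c t : ℝ) : Prop where
  continuousOn : ContinuousOn g (Icc 0 t)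
  differentiableAt : ∀ s ∈ Ioo 0 t, DifferentiableAt ℝ g s
  intervalIntegrable :
    IntervalIntegrable (fun s => (t - s) ^ (-ν) * deriv g s) volume 0 t
  integral_eq : 1 / Real.Gamma (1 - ν) * ∫ s in (0 : ℝ)..t, (t - s) ^ (-ν) * deriv g s = c

/-- The family `q k : [0, ∞) → ℝ` solves
`d^ν q_k / dt^ν = - ∑_j f_j(lam (I - B)) q_k` for `t > 0`, `q_k(0) = δ_{k0}`. -/
structure IsFractionalCauchySolution {n : ℕ} (ν lam : ℝ) (f : Fin n → BernsteinFn)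
    (q : ℕ → ℝ → ℝ) : Prop where
  init : ∀ k, q k 0 = if k = 0 then 1 else 0
  equation : ∀ k, ∀ t, 0 < t →
    HasCaputoDerivAt ν (q k) (-∑ j, (f j).shiftOp lam (fun i => q i t) k) t

variable {Ω : Type*} [MeasurableSpace Ω]

/-- `H` is a subordinator with Laplace exponent `φ`: almost surely it starts at `0` and has
nondecreasing right-continuous paths, it has independent and stationary increments, and
`E e^{-μ H(t)} = e^{-t φ(μ)}`. As paths are nondecreasing, the (truncated) subtraction
of `ℝ≥0` gives the true increments. -/
structure IsSubordinator (H : ℝ≥0 → Ω → ℝ≥0) (φ : ℝ → ℝ) (P : Measure Ω) : Prop where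
  measurable : ∀ t, Measurable (H t)
  zero : ∀ᵐ ω ∂P, H 0 ω = 0
  monotone : ∀ᵐ ω ∂P, Monotone fun t => H t ω
  rightCont : ∀ᵐ ω ∂P, ∀ t, ContinuousWithinAt (fun s => H s ω) (Ici t) t
  indepIncrements : HasIndepIncrements H P
  stationary : ∀ s t, P.map (fun ω => H (s + t) ω - H s ω) = P.map (H t)
  laplace : ∀ t μ : ℝ≥0,
    ∫ ω, Real.exp (-((μ : ℝ) * H t ω)) ∂P = Real.exp (-((t : ℝ) * φ μ))

/-- `N` is a homogeneous Poisson process of rate `lam`. As paths are nondecreasing, the (truncated)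
subtraction of `ℕ` gives the true increments. -/
structure IsPoissonProcess (N : ℝ≥0 → Ω → ℕ) (lam : ℝ≥0) (P : Measure Ω) : Prop where
  measurable : ∀ t, Measurable (N t)
  zero : ∀ᵐ ω ∂P, N 0 ω = 0
  monotone : ∀ᵐ ω ∂P, Monotone fun t => N t ω
  rightCont : ∀ᵐ ω ∂P, ∀ t, ContinuousWithinAt (fun s => N s ω) (Ici t) t
  indepIncrements : HasIndepIncrements N P
  law : ∀ s t, P.map (fun ω => N (s + t) ω - N s ω) = poissonMeasure (lam * t)

/-- The inverse `L(t) = inf {s ≥ 0 : S(s) ≥ t}` of a process `S`. -/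
def inverseProcess (S : ℝ≥0 → Ω → ℝ≥0) (t : ℝ≥0) (ω : Ω) : ℝ≥0 :=
  sInf {s | t ≤ S s ω}

/-- The process `t ↦ N(∑_j H_j(L(t)))`, where `L` is the inverse of `S`. -/
def timeChanged {n : ℕ} (N : ℝ≥0 → Ω → ℕ) (H : Fin n → ℝ≥0 → Ω → ℝ≥0) (S : ℝ≥0 → Ω → ℝ≥0)
    (t : ℝ≥0) (ω : Ω) : ℕ :=
  N (∑ j, H j (inverseProcess S t ω) ω) ω

/-- The state probabilities `p_k(t) = P(X(t) = k)`, as functions of a real time `t ≥ 0`. -/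
def stateProb (X : ℝ≥0 → Ω → ℕ) (P : Measure Ω) (k : ℕ) (t : ℝ) : ℝ :=
  P.real {ω | X t.toNNReal ω = k}

end

/-!
The proof compares two expressions for the generating function `∑_k p_k(t) u^k`, `|u| ≤ 1`.

*Probability.* A right-continuous process evaluated at an independent random time can be averaged
over that time (`integral_apply_comp`, by approximating the time from the right by grid points).
Averaging first over `N` and then over the `H j` gives
`E u^{X(t)} = E e^{-L(t) Φ}` with `Φ = ∑_j f_j(lam (1 - u))` and `L` the inverse of `S`. By
self-similarity of `S`, `L(t)` has the law of `(t / S(1))^ν`; the negative moments of `S(1)` follow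
from its Laplace transform, so `E L(t)^m = m! t^{νm} / Γ(νm + 1)`, and
`E e^{-L(t) Φ} = E_{ν,1}(-t^ν Φ)` (`IsSubordinator.integral_exp_neg_mul_inverseProcess`). This
requires that finite measures on `[0, ∞)` are determined by their Laplace transforms, which is a
consequence of the Stone–Weierstrass theorem (`Measure.ext_of_integral_exp_neg_nat`).

*Analysis.* The operator `∑_j f_j(lam (I - B))` is a lower triangular Toeplitz matrix `A` whose
entries `a_i` are the Taylor coefficients of `u ↦ ∑_j f_j(lam (1 - u))` and are absolutely summable.
As the Caputo derivative maps `t^{νm} / Γ(νm + 1)` to `t^{ν(m-1)} / Γ(ν(m-1) + 1)`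
(`hasCaputoDerivAt_fracSeries`), the first column of `E_{ν,1}(-t^ν A)` solves the Cauchy problem.
Its generating function is again `E_{ν,1}(-t^ν ∑_i a_i u^i)` (`hasSum_toeplitzSolution_mul_pow`), so
comparing coefficients identifies it with `p_k`.

*Uniqueness.* The system is triangular, so by induction on `k` the difference of two solutions
satisfies a scalar equation `d^ν g / dt^ν = -a_0 g` with `g(0) = 0`. Inverting the Caputo derivative
by the Riemann–Liouville integral (`integral_rpow_mul_caputo`) turns it into a Volterra equation, and
iterating the latter gives `g = 0` (`eq_zero_of_hasCaputoDerivAt_mul`).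
-/

open Filter Topology
open scoped BoundedContinuousFunction

/-! ### Gamma and beta integrals -/

/-- From `Γ(s + 1) ≥ ∫_R^∞ x^s e^{-x} dx`. As `R` is arbitrary, `Γ(s + 1)` grows faster than any
exponential. -/
theorem rpow_mul_exp_neg_le_Gamma {R s : ℝ} (hR : 0 < R) (hs : 0 ≤ s) :
    R ^ s * Real.exp (-R) ≤ Real.Gamma (s + 1) := by
  rw [Real.Gamma_eq_integral (by linarith), add_sub_cancel_right]
  have hint := Real.GammaIntegral_convergent (s := s + 1) (by linarith)
  rw [add_sub_cancel_right] at hint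
  rw [← integral_exp_neg_Ioi, ← integral_const_mul]
  refine (setIntegral_mono_on ?_ (hint.mono_set (Ioi_subset_Ioi hR.le)) measurableSet_Ioi ?_).trans
    (setIntegral_mono_set hint ?_ (Ioi_subset_Ioi hR.le).eventuallyLE)
  · have := (exp_neg_integrableOn_Ioi R one_pos).const_mul (R ^ s)
    simpa only [neg_mul, one_mul, IntegrableOn] using this
  · intro x hx
    rw [mul_comm]
    gcongr
    exact (mem_Ioi.1 hx).le
  · filter_upwards [ae_restrict_mem measurableSet_Ioi] with x hx
    have : (0 : ℝ) < x := hx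
    simp only [Pi.zero_apply]
    positivity

theorem summable_pow_div_Gamma {ν : ℝ} (hν : 0 < ν) (x : ℝ) :
    Summable fun m : ℕ => x ^ m / Real.Gamma (ν * m + 1) := by
  -- `R` is chosen with `R ^ ν = 2 |x| + 1`, so that `Γ(ν m + 1)` beats `|x| ^ m` by a factor `2 ^ m`
  set y : ℝ := 2 * |x| + 1 with hy
  have hy0 : 0 < y := by positivity
  set R : ℝ := y ^ ν⁻¹
  have hR : 0 < R := by positivity
  have hRν (m : ℕ) : R ^ (ν * m) = y ^ m := by
    rw [← Real.rpow_mul hy0.le, inv_mul_cancel_left₀ hν.ne', Real.rpow_natCast]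
  refine Summable.of_norm_bounded
    (g := fun m : ℕ => Real.exp R * (1 / 2) ^ m) (summable_geometric_two.mul_left _) fun m => ?_
  have hG := rpow_mul_exp_neg_le_Gamma (s := ν * m) hR (by positivity)
  rw [hRν] at hG
  have hGpos : 0 < Real.Gamma (ν * m + 1) := Real.Gamma_pos_of_pos (by positivity)
  rw [norm_div, norm_pow, Real.norm_eq_abs, Real.norm_of_nonneg hGpos.le, div_le_iff₀ hGpos]
  calc |x| ^ m ≤ (y / 2) ^ m := by gcongr; linarith
    _ = Real.exp R * (1 / 2) ^ m * (y ^ m * Real.exp (-R)) := by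
      rw [Real.exp_neg, div_pow, one_div, inv_pow]
      field_simp
    _ ≤ _ := by gcongr

theorem integral_rpow_mul_sub_rpow {a b t : ℝ} (ha : 0 < a) (hb : 0 < b) (ht : 0 < t) :
    ∫ s in (0 : ℝ)..t, s ^ (a - 1) * (t - s) ^ (b - 1) =
      t ^ (a + b - 1) * (Real.Gamma a * Real.Gamma b / Real.Gamma (a + b)) := by
  apply Complex.ofReal_injective
  have h1 := Complex.betaIntegral_scaled a b ht
  rw [Complex.betaIntegral_eq_Gamma_mul_div a b (by simpa) (by simpa)] at h1
  rw [← Complex.ofReal_add, Complex.Gamma_ofReal, Complex.Gamma_ofReal, Complex.Gamma_ofReal] at h1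
  rw [← intervalIntegral.integral_ofReal, Complex.ofReal_mul, Complex.ofReal_cpow ht.le]
  push_cast at h1 ⊢
  rw [← h1]
  refine intervalIntegral.integral_congr fun s hs => ?_
  rw [uIcc_of_le ht.le] at hs
  rw [Complex.ofReal_cpow hs.1, Complex.ofReal_cpow (sub_nonneg.2 hs.2)]
  push_cast
  rfl

theorem intervalIntegrable_rpow_mul_sub_rpow {a b t : ℝ} (ha : 0 < a) (hb : 0 < b) (ht : 0 < t) :
    IntervalIntegrable (fun s => s ^ (a - 1) * (t - s) ^ (b - 1)) volume 0 t := by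
  -- the integral is positive, which its junk value for a divergent integral is not
  refine intervalIntegral.intervalIntegrable_of_integral_ne_zero ?_
  rw [integral_rpow_mul_sub_rpow ha hb ht]
  have := Real.Gamma_pos_of_pos ha
  have := Real.Gamma_pos_of_pos hb
  have := Real.Gamma_pos_of_pos (add_pos ha hb)
  positivity

/-! ### Fractional power series and their Caputo derivatives -/

/-- The series `∑_m d_m t^{νm} / Γ(νm + 1)`, the fractional analogue of the exponential generating
function of `d`. -/
noncomputable def fracSeries (ν : ℝ) (d : ℕ → ℝ) (t : ℝ) : ℝ :=
  ∑' m : ℕ, d m * (t ^ (ν * m) / Real.Gamma (ν * m + 1))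

theorem summable_fracSeries_bound {ν : ℝ} (hν : 0 < ν) (K C : ℝ) {t : ℝ} (ht : 0 ≤ t) :
    Summable fun m : ℕ => K * C ^ m * (t ^ (ν * m) / Real.Gamma (ν * m + 1)) := by
  refine ((summable_pow_div_Gamma hν (C * t ^ ν)).mul_left K).congr fun m => ?_
  rw [mul_pow, ← Real.rpow_mul_natCast ht]
  ring

/-- The additional factor `m` is absorbed into `2 ^ m`. -/
theorem summable_deriv_fracSeries_bound {ν : ℝ} (hν : 0 < ν) {K C t : ℝ} (hK : 0 ≤ K) (hC : 0 ≤ C)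
    (ht : 0 ≤ t) :
    Summable fun m : ℕ => K * C ^ m * (ν * m * t ^ (ν * m) / Real.Gamma (ν * m + 1)) := by
  refine Summable.of_nonneg_of_le (fun m => ?_) (fun m => ?_)
    (summable_fracSeries_bound hν (K * ν) (C * 2) ht)
  · have := Real.Gamma_pos_of_pos (show 0 < ν * m + 1 by positivity)
    positivity
  · have := Real.Gamma_pos_of_pos (show 0 < ν * m + 1 by positivity)
    have h2 : (m : ℝ) ≤ 2 ^ m := by exact_mod_cast Nat.lt_two_pow_self.le
    calc K * C ^ m * (ν * m * t ^ (ν * m) / Real.Gamma (ν * m + 1))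
        = K * ν * C ^ m * (t ^ (ν * m) / Real.Gamma (ν * m + 1)) * m := by ring
      _ ≤ K * ν * C ^ m * (t ^ (ν * m) / Real.Gamma (ν * m + 1)) * 2 ^ m := by gcongr
      _ = _ := by ring

section fracSeries

variable {ν K C : ℝ} {d : ℕ → ℝ}

theorem norm_fracSeries_term_le (hν : 0 < ν) (hK : 0 ≤ K) (hC : 0 ≤ C)
    (hd : ∀ m, |d m| ≤ K * C ^ m) {s t : ℝ} (hs : 0 ≤ s) (hst : s ≤ t) (m : ℕ) :
    ‖d m * (s ^ (ν * m) / Real.Gamma (ν * m + 1))‖ ≤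
      K * C ^ m * (t ^ (ν * m) / Real.Gamma (ν * m + 1)) := by
  have := Real.Gamma_pos_of_pos (show 0 < ν * m + 1 by positivity)
  rw [norm_mul, Real.norm_eq_abs, Real.norm_of_nonneg (by positivity)]
  have := hd m
  gcongr

theorem summable_fracSeries (hν : 0 < ν) (hK : 0 ≤ K) (hC : 0 ≤ C)
    (hd : ∀ m, |d m| ≤ K * C ^ m) {t : ℝ} (ht : 0 ≤ t) :
    Summable fun m : ℕ => d m * (t ^ (ν * m) / Real.Gamma (ν * m + 1)) :=
  .of_norm_bounded (summable_fracSeries_bound hν K C ht)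
    (norm_fracSeries_term_le hν hK hC hd ht le_rfl)

theorem continuousOn_fracSeries (hν : 0 < ν) (hK : 0 ≤ K) (hC : 0 ≤ C)
    (hd : ∀ m, |d m| ≤ K * C ^ m) {t : ℝ} (ht : 0 ≤ t) :
    ContinuousOn (fracSeries ν d) (Icc 0 t) := by
  refine continuousOn_tsum (fun m => ?_) (summable_fracSeries_bound hν K C ht)
    fun m s hs => norm_fracSeries_term_le hν hK hC hd hs.1 hs.2 m
  refine ((Real.continuous_rpow_const (by positivity)).div_const _).continuousOn.const_mul _

/-- All terms of the differentiated series have at most the singularity `s^{ν-1}` of the first one at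
`s = 0`, which is integrable against the kernel of the Caputo derivative. -/
theorem norm_deriv_fracSeries_term_le (hν : 0 < ν) (hK : 0 ≤ K) (hC : 0 ≤ C)
    (hd : ∀ m, |d m| ≤ K * C ^ m) {s t : ℝ} (hs : 0 < s) (hst : s ≤ t) (m : ℕ) :
    ‖d m * (ν * m * s ^ (ν * m - 1) / Real.Gamma (ν * m + 1))‖ ≤
      t ^ (-ν) * s ^ (ν - 1) * (K * C ^ m * (ν * m * t ^ (ν * m) / Real.Gamma (ν * m + 1))) := by
  have := Real.Gamma_pos_of_pos (show 0 < ν * m + 1 by positivity)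
  rcases m.eq_zero_or_pos with rfl | hm
  · simp
  have hm' : (1 : ℝ) ≤ m := by exact_mod_cast hm
  have ht : 0 < t := hs.trans_le hst
  have hpow : s ^ (ν * m - 1) ≤ t ^ (-ν) * s ^ (ν - 1) * t ^ (ν * m) := by
    calc s ^ (ν * m - 1) = s ^ (ν - 1) * s ^ (ν * m - ν) := by
          rw [← Real.rpow_add hs]; ring_nf
      _ ≤ s ^ (ν - 1) * t ^ (ν * m - ν) := by
          have : 0 ≤ ν * m - ν := by nlinarith
          gcongr
      _ = _ := by rw [sub_eq_add_neg (ν * m), Real.rpow_add ht]; ring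
  rw [norm_mul, Real.norm_eq_abs, Real.norm_of_nonneg (by positivity)]
  calc |d m| * (ν * m * s ^ (ν * m - 1) / Real.Gamma (ν * m + 1))
      ≤ (K * C ^ m) * (ν * m * (t ^ (-ν) * s ^ (ν - 1) * t ^ (ν * m)) / Real.Gamma (ν * m + 1)) := by
        have := hd m
        gcongr
    _ = _ := by ring

theorem hasDerivAt_fracSeries (hν : 0 < ν) (hK : 0 ≤ K) (hC : 0 ≤ C)
    (hd : ∀ m, |d m| ≤ K * C ^ m) {t : ℝ} (ht : 0 < t) :
    HasDerivAt (fracSeries ν d)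
      (∑' m : ℕ, d m * (ν * m * t ^ (ν * m - 1) / Real.Gamma (ν * m + 1))) t := by
  have hmem : t ∈ Ioo (t / 2) (2 * t) := ⟨by linarith, by linarith⟩
  -- on `(t / 2, 2 t)` the factor `s ^ (ν - 1)` is bounded
  have hb (s : ℝ) (hs : s ∈ Ioo (t / 2) (2 * t)) :
      s ^ (ν - 1) ≤ (2 * t) ^ ν * (t / 2)⁻¹ := by
    have h0 : 0 < s := by linarith [hs.1]
    have h1 := hs.1
    have h2 := hs.2.le
    rw [Real.rpow_sub_one h0.ne', div_eq_mul_inv]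
    gcongr
  refine hasDerivAt_tsum_of_isPreconnected (t := Ioo (t / 2) (2 * t))
    (g' := fun m s => d m * (ν * m * s ^ (ν * m - 1) / Real.Gamma (ν * m + 1)))
    (((summable_deriv_fracSeries_bound hν hK hC (t := 2 * t) (by positivity)).mul_left
      ((2 * t) ^ (-ν) * ((2 * t) ^ ν * (t / 2)⁻¹))))
    isOpen_Ioo isPreconnected_Ioo (fun m s hs => ?_) (fun m s hs => ?_) hmem
    (summable_fracSeries hν hK hC hd ht.le) hmem
  · have h0 : 0 < s := by linarith [hs.1]
    have h := Real.hasDerivAt_rpow_const (x := s) (p := ν * m) (Or.inl h0.ne')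
    exact (h.div_const (Real.Gamma (ν * m + 1))).const_mul (d m)
  · have h0 : 0 < s := by linarith [hs.1]
    refine (norm_deriv_fracSeries_term_le hν hK hC hd h0 hs.2.le m).trans ?_
    have hG := Real.Gamma_pos_of_pos (show 0 < ν * m + 1 by positivity)
    refine mul_le_mul_of_nonneg_right ?_ (by positivity)
    exact mul_le_mul_of_nonneg_left (hb s hs) (by positivity)

/-- The Caputo derivative of order `ν` of `t^{νm} / Γ(νm + 1)` is `t^{ν(m-1)} / Γ(ν(m-1) + 1)`, so
that on `fracSeries` it acts by shifting the coefficients. -/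
theorem hasCaputoDerivAt_fracSeries (hν : ν ∈ Ioo (0 : ℝ) 1) (hK : 0 ≤ K) (hC : 0 ≤ C)
    (hd : ∀ m, |d m| ≤ K * C ^ m) {t : ℝ} (ht : 0 < t) :
    HasCaputoDerivAt ν (fracSeries ν d) (fracSeries ν (fun m => d (m + 1)) t) t := by
  obtain ⟨hν0, hν1⟩ := hν
  have hG1 : 0 < Real.Gamma (1 - ν) := Real.Gamma_pos_of_pos (by linarith)
  have hsum := summable_deriv_fracSeries_bound hν0 hK hC ht.le
  have hbeta : IntervalIntegrable (fun s => (t - s) ^ (-ν) * s ^ (ν - 1)) volume 0 t := by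
    have := intervalIntegrable_rpow_mul_sub_rpow hν0 (sub_pos.2 hν1) ht
    simpa only [sub_sub_cancel_left, mul_comm] using this
  set F' : ℝ → ℝ := fun s => ∑' m : ℕ, d m * (ν * m * s ^ (ν * m - 1) / Real.Gamma (ν * m + 1))
    with hF'
  have hderiv (s : ℝ) (hs : 0 < s) : deriv (fracSeries ν d) s = F' s :=
    (hasDerivAt_fracSeries hν0 hK hC hd hs).deriv
  have hterm (m : ℕ) (s : ℝ) (hs : s ∈ Ioc 0 t) :=
    norm_deriv_fracSeries_term_le hν0 hK hC hd hs.1 hs.2 m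
  have hint (m : ℕ) : ∫ s in (0 : ℝ)..t,
      (t - s) ^ (-ν) * (d m * (ν * m * s ^ (ν * m - 1) / Real.Gamma (ν * m + 1))) =
      if m = 0 then 0 else Real.Gamma (1 - ν) *
        (d m * (t ^ (ν * (m - 1 : ℝ)) / Real.Gamma (ν * (m - 1 : ℝ) + 1))) := by
    rcases m.eq_zero_or_pos with rfl | hm
    · simp
    have hm' : (0 : ℝ) < ν * m := by positivity
    have h1 := integral_rpow_mul_sub_rpow hm' (sub_pos.2 hν1) ht
    rw [sub_sub_cancel_left, show ν * m + (1 - ν) - 1 = ν * (m - 1 : ℝ) by ring,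
      show ν * m + (1 - ν) = ν * (m - 1 : ℝ) + 1 by ring] at h1
    rw [if_neg hm.ne', Real.Gamma_add_one hm'.ne']
    have hG := Real.Gamma_pos_of_pos hm'
    calc _ = ∫ s in (0 : ℝ)..t, d m / Real.Gamma (ν * m) * (s ^ (ν * m - 1) * (t - s) ^ (-ν)) := by
          congr 1 with s
          field_simp
      _ = _ := by
          rw [intervalIntegral.integral_const_mul, h1]
          field_simp
  have hmeas (m : ℕ) : AEStronglyMeasurable
      (fun s => (t - s) ^ (-ν) * (d m * (ν * m * s ^ (ν * m - 1) / Real.Gamma (ν * m + 1))))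
      (volume.restrict (uIoc 0 t)) := by
    apply Measurable.aestronglyMeasurable
    fun_prop
  have hHS : HasSum (fun m : ℕ => ∫ s in (0 : ℝ)..t,
      (t - s) ^ (-ν) * (d m * (ν * m * s ^ (ν * m - 1) / Real.Gamma (ν * m + 1))))
      (∫ s in (0 : ℝ)..t, (t - s) ^ (-ν) * F' s) := by
    refine intervalIntegral.hasSum_integral_of_dominated_convergence
      (fun m s => (t - s) ^ (-ν) * (t ^ (-ν) * s ^ (ν - 1) *
        (K * C ^ m * (ν * m * t ^ (ν * m) / Real.Gamma (ν * m + 1))))) hmeas ?_ ?_ ?_ ?_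
    · refine fun m => ae_of_all _ fun s hs => ?_
      rw [uIoc_of_le ht.le] at hs
      have : 0 ≤ t - s := sub_nonneg.2 hs.2
      rw [norm_mul, Real.norm_of_nonneg (by positivity : 0 ≤ (t - s) ^ (-ν))]
      exact mul_le_mul_of_nonneg_left (hterm m s hs) (by positivity)
    · exact ae_of_all _ fun s hs => (hsum.mul_left _).mul_left _
    · simp_rw [tsum_mul_left]
      refine (hbeta.mul_const (t ^ (-ν) *
        ∑' m : ℕ, (K * C ^ m * (ν * m * t ^ (ν * m) / Real.Gamma (ν * m + 1))))).congr_ae ?_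
      exact ae_of_all _ fun s => by ring
    · refine ae_of_all _ fun s hs => ?_
      rw [uIoc_of_le ht.le] at hs
      exact (Summable.of_norm_bounded (hsum.mul_left _) fun m => hterm m s hs).hasSum.mul_left _
  refine ⟨continuousOn_fracSeries hν0 hK hC hd ht.le, fun s hs =>
    (hasDerivAt_fracSeries hν0 hK hC hd hs.1).differentiableAt, ?_, ?_⟩
  · refine (hbeta.mul_const (t ^ (-ν) *
        ∑' m : ℕ, (K * C ^ m * (ν * m * t ^ (ν * m) / Real.Gamma (ν * m + 1))))).mono_fun ?_ ?_
    · have := measurable_deriv (fracSeries ν d)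
      apply Measurable.aestronglyMeasurable
      fun_prop
    · rw [uIoc_of_le ht.le]
      filter_upwards [ae_restrict_mem measurableSet_Ioc] with s hs
      have h0 : 0 ≤ t - s := sub_nonneg.2 hs.2
      have h1 := hs.1
      rw [hderiv s hs.1, norm_mul, mul_assoc, norm_mul,
        Real.norm_of_nonneg (by positivity : 0 ≤ (t - s) ^ (-ν))]
      refine mul_le_mul_of_nonneg_left ?_ (by positivity)
      refine (tsum_of_norm_bounded (hsum.mul_left _).hasSum fun m => hterm m s hs).trans ?_
      rw [tsum_mul_left]
      exact (le_of_eq (by ring)).trans (le_abs_self _)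
  · rw [intervalIntegral.integral_congr_ae (g := fun s => (t - s) ^ (-ν) * F' s)
      (ae_of_all _ fun s hs => by rw [uIoc_of_le ht.le] at hs; simp only [hderiv s hs.1]),
      ← hHS.tsum_eq, (hHS.summable).tsum_eq_zero_add]
    simp_rw [hint]
    simp only [if_true, Nat.add_eq_zero_iff, one_ne_zero, and_false, if_false, zero_add,
      tsum_mul_left, Nat.cast_add, Nat.cast_one, add_sub_cancel_right]
    rw [← mul_assoc, one_div, inv_mul_cancel₀ hG1.ne', one_mul, fracSeries]

end fracSeries

/-! ### Uniqueness for the scalar Caputo equation -/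

section CaputoUniqueness

variable {ν : ℝ} {g c : ℝ → ℝ}

theorem HasCaputoDerivAt.intervalIntegrable_deriv (hν : 0 < ν) {t y : ℝ} (ht : 0 < t)
    (hg : HasCaputoDerivAt ν g y t) : IntervalIntegrable (deriv g) volume 0 t := by
  refine (hg.intervalIntegrable.const_mul (t ^ ν)).mono_fun
    (measurable_deriv g).aestronglyMeasurable ?_
  rw [uIoc_of_le ht.le, ← restrict_Ioo_eq_restrict_Ioc]
  filter_upwards [ae_restrict_mem measurableSet_Ioo] with s hs
  have h1 : 0 < t - s := sub_pos.2 hs.2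
  have h2 : (t - s) ^ ν ≤ t ^ ν := Real.rpow_le_rpow h1.le (by linarith [hs.1]) hν.le
  rw [norm_mul, norm_mul, Real.norm_of_nonneg (by positivity : 0 ≤ t ^ ν),
    Real.norm_of_nonneg (by positivity : 0 ≤ (t - s) ^ (-ν)), ← mul_assoc, Real.rpow_neg h1.le, ← div_eq_mul_inv]
  exact le_mul_of_one_le_left (norm_nonneg _) ((one_le_div (by positivity)).2 h2)

theorem integral_sub_rpow_mul_sub_rpow_neg (hν : ν ∈ Ioo (0 : ℝ) 1) {r t : ℝ} (hrt : r < t) :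
    ∫ s in r..t, (t - s) ^ (ν - 1) * (s - r) ^ (-ν) = Real.Gamma ν * Real.Gamma (1 - ν) := by
  have h := integral_rpow_mul_sub_rpow (sub_pos.2 hν.2) hν.1 (sub_pos.2 hrt)
  rw [sub_sub_cancel_left, show 1 - ν + ν = 1 by ring, Real.Gamma_one, sub_self, Real.rpow_zero,
    one_mul, div_one] at h
  rw [mul_comm (Real.Gamma ν), ← h]
  have := intervalIntegral.integral_comp_sub_right (a := r) (b := t)
    (fun s => s ^ (-ν) * (t - r - s) ^ (ν - 1)) r
  rw [sub_self] at this
  rw [← this]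
  congr 1 with s
  rw [mul_comm, sub_sub_sub_cancel_right]

theorem intervalIntegrable_sub_rpow_mul_sub_rpow_neg (hν : ν ∈ Ioo (0 : ℝ) 1) {r t : ℝ}
    (hrt : r < t) :
    IntervalIntegrable (fun s => (t - s) ^ (ν - 1) * (s - r) ^ (-ν)) volume r t := by
  refine intervalIntegral.intervalIntegrable_of_integral_ne_zero ?_
  rw [integral_sub_rpow_mul_sub_rpow_neg hν hrt]
  exact mul_ne_zero (Real.Gamma_pos_of_pos hν.1).ne' (Real.Gamma_pos_of_pos (sub_pos.2 hν.2)).ne'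

/-- The Riemann–Liouville integral of order `ν` of the Caputo derivative of order `ν` gives back the
function: after Fubini, the kernels `(t - s)^{ν - 1}` and `(s - r)^{-ν}` convolve to a constant. -/
theorem integral_rpow_mul_caputo (hν : ν ∈ Ioo (0 : ℝ) 1) {t : ℝ} (ht : 0 < t)
    (hg : ∀ s ∈ Ioc 0 t, HasCaputoDerivAt ν g (c s) s) :
    ∫ s in (0 : ℝ)..t, (t - s) ^ (ν - 1) * c s = Real.Gamma ν * (g t - g 0) := by
  obtain ⟨hν0, hν1⟩ := id hν
  have hG : 0 < Real.Gamma (1 - ν) := Real.Gamma_pos_of_pos (by linarith)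
  have hgt := hg t ⟨ht, le_rfl⟩
  have hg' := hgt.intervalIntegrable_deriv hν0 ht
  set κ : Measure ℝ := volume.restrict (Ioc 0 t) with hκ
  have hmemκ : ∀ᵐ s ∂κ, s ∈ Ioo 0 t := by
    rw [hκ, ← restrict_Ioo_eq_restrict_Ioc]
    exact ae_restrict_mem measurableSet_Ioo
  -- the integrand on the triangle `r < s`, extended by zero to the square
  let h : ℝ → ℝ → ℝ := fun s r =>
    (Ioi r).indicator (fun s => (t - s) ^ (ν - 1) * (s - r) ^ (-ν)) s * deriv g r
  have hmeas : Measurable (Function.uncurry h) := by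
    have h1 := measurable_deriv g
    have h2 : MeasurableSet {p : ℝ × ℝ | p.2 < p.1} := measurableSet_lt measurable_snd measurable_fst
    refine Measurable.mul ?_ (h1.comp measurable_snd)
    exact Measurable.indicator (f := fun p : ℝ × ℝ => (t - p.1) ^ (ν - 1) * (p.1 - p.2) ^ (-ν))
      (by fun_prop) h2
  have hset (r : ℝ) (hr : 0 < r) : Ioc 0 t ∩ Ioi r = Ioc r t := by
    ext s
    simp only [mem_inter_iff, mem_Ioc, mem_Ioi]
    exact ⟨fun h => ⟨h.2, h.1.2⟩, fun h => ⟨⟨hr.trans h.1, h.2⟩, h.1⟩⟩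
  have hkern (r : ℝ) (hr : r ∈ Ioo 0 t) :
      ∫ s, (Ioi r).indicator (fun s => (t - s) ^ (ν - 1) * (s - r) ^ (-ν)) s ∂κ =
        Real.Gamma ν * Real.Gamma (1 - ν) := by
    rw [integral_indicator measurableSet_Ioi, hκ, Measure.restrict_restrict measurableSet_Ioi,
      inter_comm, hset r hr.1, ← intervalIntegral.integral_of_le hr.2.le,
      integral_sub_rpow_mul_sub_rpow_neg hν hr.2]
  have hkern_int (r : ℝ) (hr : r ∈ Ioo 0 t) : Integrable
      ((Ioi r).indicator (fun s => (t - s) ^ (ν - 1) * (s - r) ^ (-ν))) κ := by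
    rw [integrable_indicator_iff measurableSet_Ioi, IntegrableOn, hκ,
      Measure.restrict_restrict measurableSet_Ioi, inter_comm, hset r hr.1]
    exact (intervalIntegrable_iff_integrableOn_Ioc_of_le hr.2.le).1
      (intervalIntegrable_sub_rpow_mul_sub_rpow_neg hν hr.2)
  have hnonneg (r s : ℝ) (hs : s ∈ Ioo 0 t) :
      0 ≤ (Ioi r).indicator (fun s => (t - s) ^ (ν - 1) * (s - r) ^ (-ν)) s := by
    refine indicator_apply_nonneg fun hrs => ?_
    have h1 : 0 ≤ t - s := sub_nonneg.2 hs.2.le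
    have h2 : 0 ≤ s - r := sub_nonneg.2 (mem_Ioi.1 hrs).le
    positivity
  have hgint : Integrable (deriv g) κ :=
    (intervalIntegrable_iff_integrableOn_Ioc_of_le ht.le).1 hg'
  have hint : Integrable (Function.uncurry h) (κ.prod κ) := by
    rw [integrable_prod_iff' hmeas.aestronglyMeasurable]
    refine ⟨?_, ?_⟩
    · filter_upwards [hmemκ] with r hr
      exact (hkern_int r hr).mul_const (deriv g r)
    · refine (hgint.norm.const_mul (Real.Gamma ν * Real.Gamma (1 - ν))).congr ?_
      filter_upwards [hmemκ] with r hr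
      rw [← hkern r hr, ← integral_mul_const]
      refine integral_congr_ae ?_
      filter_upwards [hmemκ] with s hs
      simp only [h, Function.uncurry_apply_pair]
      rw [norm_mul, Real.norm_of_nonneg (hnonneg r s hs)]
  have hinner (s : ℝ) (hs : s ∈ Ioo 0 t) :
      ∫ r, h s r ∂κ = (t - s) ^ (ν - 1) * (Real.Gamma (1 - ν) * c s) := by
    have h1 := (hg s ⟨hs.1, hs.2.le⟩).integral_eq
    rw [← h1, one_div, mul_inv_cancel_left₀ hG.ne', intervalIntegral.integral_of_le hs.1.le,
      ← integral_const_mul, ← restrict_Ioo_eq_restrict_Ioc]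
    have h2 : (fun r => h s r) =
        (Iio s).indicator (fun r => (t - s) ^ (ν - 1) * ((s - r) ^ (-ν) * deriv g r)) := by
      ext r
      by_cases hrs : r < s
      · simp only [h, indicator_of_mem (mem_Ioi.2 hrs), indicator_of_mem (mem_Iio.2 hrs)]
        ring
      · simp only [h, indicator_of_notMem (show s ∉ Ioi r from hrs),
          indicator_of_notMem (show r ∉ Iio s from hrs), zero_mul]
    rw [h2, integral_indicator measurableSet_Iio, hκ, Measure.restrict_restrict measurableSet_Iio]
    congr 2
    ext r
    simp only [mem_inter_iff, mem_Iio, mem_Ioc, mem_Ioo]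
    exact ⟨fun h => ⟨h.2.1, h.1⟩, fun h => ⟨h.2, h.1, (h.2.trans hs.2).le⟩⟩
  have hswap := integral_integral_swap hint
  have hleft : ∫ s, ∫ r, h s r ∂κ ∂κ =
      Real.Gamma (1 - ν) * ∫ s in (0 : ℝ)..t, (t - s) ^ (ν - 1) * c s := by
    rw [intervalIntegral.integral_of_le ht.le, ← integral_const_mul]
    refine integral_congr_ae ?_
    filter_upwards [hmemκ] with s hs
    rw [hinner s hs]
    ring
  have hright : ∫ r, ∫ s, h s r ∂κ ∂κ = Real.Gamma ν * Real.Gamma (1 - ν) * (g t - g 0) := by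
    rw [← intervalIntegral.integral_eq_sub_of_hasDerivAt_of_le ht.le hgt.continuousOn
      (fun s hs => (hgt.differentiableAt s hs).hasDerivAt) hg',
      intervalIntegral.integral_of_le ht.le, ← integral_const_mul]
    refine integral_congr_ae ?_
    filter_upwards [hmemκ] with r hr
    rw [← hkern r hr, ← integral_mul_const]
  rw [hleft, hright] at hswap
  exact mul_left_cancel₀ hG.ne' (by linarith)

/-- A Gronwall lemma: a solution of the homogeneous scalar equation satisfies `g = -a J^ν g` for the
Riemann–Liouville integral `J^ν`, and iterating this bounds `|g|` by the terms of a convergent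
series. -/
theorem eq_zero_of_hasCaputoDerivAt_mul (hν : ν ∈ Ioo (0 : ℝ) 1) (a : ℝ)
    (hg : ∀ t, 0 < t → HasCaputoDerivAt ν g (a * g t) t) (h0 : g 0 = 0) {t : ℝ} (ht : 0 ≤ t) :
    g t = 0 := by
  obtain ⟨hν0, hν1⟩ := id hν
  rcases ht.eq_or_lt with rfl | ht
  · exact h0
  have hGν : 0 < Real.Gamma ν := Real.Gamma_pos_of_pos hν0
  have hvolt (s : ℝ) (hs : 0 < s) :
      Real.Gamma ν * g s = ∫ r in (0 : ℝ)..s, (s - r) ^ (ν - 1) * (a * g r) := by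
    rw [integral_rpow_mul_caputo hν hs fun r hr => hg r hr.1, h0, sub_zero]
  obtain ⟨M, hM⟩ := isCompact_Icc.exists_bound_of_continuousOn (hg t ht).continuousOn
  have hbound (n : ℕ) : ∀ s ∈ Icc 0 t,
      |g s| ≤ M * |a| ^ n * (s ^ (ν * n) / Real.Gamma (ν * n + 1)) := by
    have hM0 : 0 ≤ M := (norm_nonneg _).trans (hM 0 ⟨le_rfl, ht.le⟩)
    induction n with
    | zero => intro s hs; simpa using hM s hs
    | succ n ih =>
      intro s hs
      have hGn := Real.Gamma_pos_of_pos (show 0 < ν * n + 1 by positivity)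
      have hGn' := Real.Gamma_pos_of_pos (show 0 < ν * (n + 1 : ℕ) + 1 by positivity)
      rcases hs.1.eq_or_lt with rfl | hs0
      · rw [h0, abs_zero]
        positivity
      have hI : IntervalIntegrable (fun r => r ^ (ν * n) * (s - r) ^ (ν - 1)) volume 0 s := by
        have := intervalIntegrable_rpow_mul_sub_rpow (show 0 < ν * n + 1 by positivity) hν0 hs0
        rwa [add_sub_cancel_right] at this
      have hIval := integral_rpow_mul_sub_rpow (show 0 < ν * n + 1 by positivity) hν0 hs0
      rw [add_sub_cancel_right, show ν * n + 1 + ν - 1 = ν * (n + 1 : ℕ) by push_cast; ring,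
        show ν * n + 1 + ν = ν * (n + 1 : ℕ) + 1 by push_cast; ring] at hIval
      refine le_of_mul_le_mul_left ?_ hGν
      calc Real.Gamma ν * |g s| = ‖∫ r in (0 : ℝ)..s, (s - r) ^ (ν - 1) * (a * g r)‖ := by
            rw [← hvolt s hs0, norm_mul, Real.norm_of_nonneg hGν.le, Real.norm_eq_abs]
        _ ≤ ∫ r in (0 : ℝ)..s, (M * |a| ^ (n + 1) / Real.Gamma (ν * n + 1)) *
              (r ^ (ν * n) * (s - r) ^ (ν - 1)) := by
            refine intervalIntegral.norm_integral_le_of_norm_le hs0.le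
              (ae_of_all _ fun r hr => ?_) (hI.const_mul _)
            have hsr : 0 ≤ s - r := sub_nonneg.2 hr.2
            have := ih r ⟨hr.1.le, hr.2.trans hs.2⟩
            rw [norm_mul, norm_mul, Real.norm_of_nonneg (by positivity), Real.norm_eq_abs,
              Real.norm_eq_abs]
            calc (s - r) ^ (ν - 1) * (|a| * |g r|) ≤ (s - r) ^ (ν - 1) *
                  (|a| * (M * |a| ^ n * (r ^ (ν * n) / Real.Gamma (ν * n + 1)))) := by gcongr
              _ = _ := by ring
        _ = _ := by
            rw [intervalIntegral.integral_const_mul, hIval]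
            field_simp
  have hlim : Tendsto (fun n : ℕ => M * |a| ^ n * (t ^ (ν * n) / Real.Gamma (ν * n + 1))) atTop
      (𝓝 0) := (summable_fracSeries_bound hν0 M |a| ht.le).tendsto_atTop_zero
  exact abs_nonpos_iff.1 (ge_of_tendsto' hlim fun n => hbound n t ⟨ht.le, le_rfl⟩)

theorem HasCaputoDerivAt.congr {g₁ g₂ : ℝ → ℝ} {y t : ℝ} (h : HasCaputoDerivAt ν g₁ y t)
    (heq : EqOn g₂ g₁ (Icc 0 t)) (ht : 0 < t) : HasCaputoDerivAt ν g₂ y t := by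
  have hev (s : ℝ) (hs : s ∈ Ioo 0 t) : g₂ =ᶠ[𝓝 s] g₁ :=
    heq.eventuallyEq_of_mem (Icc_mem_nhds hs.1 hs.2)
  have hcongr : (fun s => (t - s) ^ (-ν) * deriv g₁ s) =ᵐ[volume.restrict (uIoc 0 t)]
      fun s => (t - s) ^ (-ν) * deriv g₂ s := by
    rw [uIoc_of_le ht.le, ← restrict_Ioo_eq_restrict_Ioc]
    filter_upwards [ae_restrict_mem measurableSet_Ioo] with s hs
    rw [(hev s hs).deriv_eq]
  refine ⟨h.continuousOn.congr heq, fun s hs => (h.differentiableAt s hs).congr_of_eventuallyEq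
    (hev s hs), h.intervalIntegrable.congr_ae hcongr, ?_⟩
  rw [← h.integral_eq, intervalIntegral.integral_congr_ae_restrict hcongr]

theorem HasCaputoDerivAt.sub {g₁ g₂ : ℝ → ℝ} {y₁ y₂ t : ℝ} (h₁ : HasCaputoDerivAt ν g₁ y₁ t)
    (h₂ : HasCaputoDerivAt ν g₂ y₂ t) (ht : 0 < t) :
    HasCaputoDerivAt ν (fun s => g₁ s - g₂ s) (y₁ - y₂) t := by
  have hcongr : (fun s => (t - s) ^ (-ν) * deriv g₁ s - (t - s) ^ (-ν) * deriv g₂ s)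
      =ᵐ[volume.restrict (uIoc 0 t)] fun s => (t - s) ^ (-ν) * deriv (fun s => g₁ s - g₂ s) s := by
    rw [uIoc_of_le ht.le, ← restrict_Ioo_eq_restrict_Ioc]
    filter_upwards [ae_restrict_mem measurableSet_Ioo] with s hs
    rw [deriv_fun_sub (h₁.differentiableAt s hs) (h₂.differentiableAt s hs), mul_sub]
  refine ⟨h₁.continuousOn.sub h₂.continuousOn, fun s hs => (h₁.differentiableAt s hs).sub
    (h₂.differentiableAt s hs), (h₁.intervalIntegrable.sub h₂.intervalIntegrable).congr_ae hcongr,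
    ?_⟩
  rw [← intervalIntegral.integral_congr_ae_restrict hcongr, intervalIntegral.integral_sub
    h₁.intervalIntegrable h₂.intervalIntegrable, mul_sub, h₁.integral_eq, h₂.integral_eq]

end CaputoUniqueness

/-! ### The operator as a lower triangular Toeplitz matrix -/

/-- The coefficient of `u ^ i` in `1 - e^{-lam (1 - u) s}`: minus the Poisson weight
`e^{-lam s} (lam s) ^ i / i!`, with `1` added for `i = 0`. -/
noncomputable def poissonDefect (lam s : ℝ) (i : ℕ) : ℝ :=
  (if i = 0 then 1 else 0) - Real.exp (-(s * lam)) * ((s * lam) ^ i / (i.factorial : ℝ))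

theorem hasSum_poissonDefect_mul_pow (lam s u : ℝ) :
    HasSum (fun i => poissonDefect lam s i * u ^ i) (1 - Real.exp (-(lam * (1 - u) * s))) := by
  have h1 : HasSum (fun i : ℕ => (if i = 0 then (1 : ℝ) else 0)) 1 := hasSum_ite_eq 0 1
  have h2 : HasSum (fun i : ℕ => (s * lam * u) ^ i / (i.factorial : ℝ)) (Real.exp (s * lam * u)) := by
    rw [Real.exp_eq_exp_ℝ]
    exact NormedSpace.expSeries_div_hasSum_exp _
  have h3 := h1.sub (h2.mul_left (Real.exp (-(s * lam))))
  rw [← Real.exp_add, show -(s * lam) + s * lam * u = -(lam * (1 - u) * s) by ring] at h3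
  refine h3.congr_fun fun i => ?_
  rw [poissonDefect, sub_mul, mul_pow _ u]
  rcases eq_or_ne i 0 with rfl | hi
  · simp
  · simp only [hi, if_false, zero_mul]
    ring

theorem abs_poissonDefect_eq {lam s : ℝ} (hlam : 0 ≤ lam) (hs : 0 ≤ s) (i : ℕ) :
    |poissonDefect lam s i| =
      (if i = 0 then 2 * (1 - Real.exp (-(s * lam))) else 0) - poissonDefect lam s i := by
  rcases eq_or_ne i 0 with rfl | hi
  · have : Real.exp (-(s * lam)) ≤ 1 := Real.exp_le_one_iff.2 (by nlinarith)
    simp only [poissonDefect, if_true, pow_zero, Nat.factorial_zero, Nat.cast_one, div_one, mul_one]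
    rw [abs_of_nonneg (by linarith)]
    ring
  · simp only [poissonDefect, hi, if_false, zero_sub, abs_neg, neg_neg]
    exact abs_of_nonneg (by positivity)

theorem hasSum_abs_poissonDefect {lam s : ℝ} (hlam : 0 ≤ lam) (hs : 0 ≤ s) :
    HasSum (fun i => |poissonDefect lam s i|) (2 * (1 - Real.exp (-(s * lam)))) := by
  have h1 : HasSum (fun i : ℕ => if i = 0 then 2 * (1 - Real.exp (-(s * lam))) else 0)
    (2 * (1 - Real.exp (-(s * lam)))) := hasSum_ite_eq 0 _
  have h2 := h1.sub (hasSum_poissonDefect_mul_pow lam s 1)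
  simp only [one_pow, mul_one, sub_self, mul_zero, zero_mul, neg_zero, Real.exp_zero,
    sub_zero] at h2
  exact h2.congr_fun fun i => abs_poissonDefect_eq hlam hs i

namespace BernsteinFn

variable (f : BernsteinFn)

theorem ae_levy_pos : ∀ᵐ s ∂f.levy, 0 < s := by
  rw [ae_iff]
  simp only [not_lt]
  exact f.levy_Iic

theorem integrable_one_sub_exp {lam : ℝ} (hlam : 0 ≤ lam) :
    Integrable (fun s => 1 - Real.exp (-(s * lam))) f.levy := by
  have hmin : Integrable (fun s : ℝ => min 1 s) f.levy := by
    refine (lintegral_ofReal_ne_top_iff_integrable (by fun_prop) ?_).1 f.lintegral_min_lt_top.ne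
    filter_upwards [f.ae_levy_pos] with s hs
    exact le_min zero_le_one hs.le
  refine (hmin.const_mul (max 1 lam)).mono' (by fun_prop) ?_
  filter_upwards [f.ae_levy_pos] with s hs
  have h1 : Real.exp (-(s * lam)) ≤ 1 := Real.exp_le_one_iff.2 (by nlinarith)
  have h2 := Real.add_one_le_exp (-(s * lam))
  have h3 := Real.exp_pos (-(s * lam))
  rw [Real.norm_of_nonneg (by linarith)]
  rcases le_total 1 s with h | h
  · rw [min_eq_left h, mul_one]
    exact le_max_of_le_left (by linarith)
  · rw [min_eq_right h]
    calc 1 - Real.exp (-(s * lam)) ≤ lam * s := by linarith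
      _ ≤ _ := by gcongr; exact le_max_right _ _

theorem integrable_poissonDefect {lam : ℝ} (hlam : 0 ≤ lam) (i : ℕ) :
    Integrable (fun s => poissonDefect lam s i) f.levy := by
  refine ((f.integrable_one_sub_exp hlam).const_mul 2).mono'
    (by unfold poissonDefect; fun_prop) ?_
  filter_upwards [f.ae_levy_pos] with s hs
  exact le_hasSum (hasSum_abs_poissonDefect hlam hs.le) i fun _ _ => abs_nonneg _

theorem summable_integral_abs_poissonDefect {lam : ℝ} (hlam : 0 ≤ lam) :
    Summable fun i => ∫ s, |poissonDefect lam s i| ∂f.levy := by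
  refine summable_of_sum_range_le (c := ∫ s, 2 * (1 - Real.exp (-(s * lam))) ∂f.levy)
    (fun i => integral_nonneg fun s => abs_nonneg _) fun n => ?_
  rw [← integral_finsetSum _ fun i _ => (f.integrable_poissonDefect hlam i).abs]
  refine integral_mono_ae (integrable_finsetSum _ fun i _ =>
    (f.integrable_poissonDefect hlam i).abs) ((f.integrable_one_sub_exp hlam).const_mul 2) ?_
  filter_upwards [f.ae_levy_pos] with s hs
  exact sum_le_hasSum _ (fun _ _ => abs_nonneg _) (hasSum_abs_poissonDefect hlam hs.le)

/-- The entries of the Toeplitz matrix `f(lam (I - B))`, that is, the Taylor coefficients of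
`u ↦ f(lam (1 - u))` at `0`. -/
noncomputable def shiftCoeff (lam : ℝ) (i : ℕ) : ℝ :=
  f.drift * lam * ((if i = 0 then 1 else 0) - if i = 1 then 1 else 0) +
    ∫ s, poissonDefect lam s i ∂f.levy

theorem hasSum_shiftCoeff_mul_pow {lam : ℝ} (hlam : 0 ≤ lam) {u : ℝ} (hu : |u| ≤ 1) :
    HasSum (fun i => f.shiftCoeff lam i * u ^ i) (f.eval (lam * (1 - u))) := by
  have h0 : HasSum (fun i : ℕ => (if i = 0 then (1 : ℝ) else 0)) 1 := hasSum_ite_eq 0 1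
  have h1 : HasSum (fun i : ℕ => (if i = 1 then u else 0)) u := hasSum_ite_eq 1 u
  have h2 := (h0.sub h1).mul_left (f.drift * lam)
  have h3 : HasSum (fun i => ∫ s, poissonDefect lam s i * u ^ i ∂f.levy)
      (∫ s, ∑' i, poissonDefect lam s i * u ^ i ∂f.levy) := by
    refine hasSum_integral_of_summable_integral_norm
      (fun i => (f.integrable_poissonDefect hlam i).mul_const _) ?_
    refine Summable.of_nonneg_of_le (fun i => integral_nonneg fun s => norm_nonneg _) (fun i => ?_)
      (f.summable_integral_abs_poissonDefect hlam)
    refine integral_mono ((f.integrable_poissonDefect hlam i).mul_const _).norm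
      (f.integrable_poissonDefect hlam i).abs fun s => ?_
    rw [norm_mul, norm_pow, Real.norm_eq_abs, Real.norm_eq_abs]
    exact mul_le_of_le_one_right (abs_nonneg _) (pow_le_one₀ (abs_nonneg _) hu)
  simp_rw [(hasSum_poissonDefect_mul_pow lam _ u).tsum_eq] at h3
  have h4 := h2.add h3
  rw [mul_assoc] at h4
  refine h4.congr_fun fun i => ?_
  rw [shiftCoeff, add_mul, integral_mul_const]
  congr 1
  rcases i with _ | _ | i <;> simp

theorem summable_abs_shiftCoeff {lam : ℝ} (hlam : 0 ≤ lam) :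
    Summable fun i => |f.shiftCoeff lam i| := by
  have h0 : HasSum (fun i : ℕ => (if i = 0 then (1 : ℝ) else 0)) 1 := hasSum_ite_eq 0 1
  have h1 : HasSum (fun i : ℕ => (if i = 1 then (1 : ℝ) else 0)) 1 := hasSum_ite_eq 1 1
  refine Summable.of_nonneg_of_le (fun i => abs_nonneg _) (fun i => abs_add_le _ _)
    (((h0.sub h1).mul_left (f.drift * lam)).summable.abs.add ?_)
  exact Summable.of_nonneg_of_le (fun i => abs_nonneg _) (fun i => abs_integral_le_integral_abs)
      (f.summable_integral_abs_poissonDefect hlam)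

end BernsteinFn

theorem iterate_backShift (p : ℕ → ℝ) {m k : ℕ} (hmk : m ≤ k) : backShift^[m] p k = p (k - m) := by
  induction m generalizing k with
  | zero => simp
  | succ m ih =>
    obtain ⟨k, rfl⟩ : ∃ j, k = j + 1 := ⟨k - 1, by omega⟩
    rw [Function.iterate_succ_apply', backShift, ih (by omega), Nat.add_sub_add_right]

/-- The lower triangular Toeplitz operator with coefficients `a`. -/
def toeplitz (a p : ℕ → ℝ) (k : ℕ) : ℝ :=
  ∑ i ∈ Finset.range (k + 1), a i * p (k - i)

theorem BernsteinFn.shiftOp_eq_toeplitz (f : BernsteinFn) {lam : ℝ} (hlam : 0 ≤ lam) (p : ℕ → ℝ)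
    (k : ℕ) : f.shiftOp lam p k = toeplitz (f.shiftCoeff lam) p k := by
  have h0 : ∑ i ∈ Finset.range (k + 1), (if i = 0 then (1 : ℝ) else 0) * p (k - i) = p k := by
    simp
  have h1 : ∑ i ∈ Finset.range (k + 1), (if i = 1 then (1 : ℝ) else 0) * p (k - i) =
      backShift p k := by
    rcases k with _ | k
    · simp [backShift]
    · simp [backShift]
  have h2 (s : ℝ) : p k - expShift lam s p k =
      ∑ i ∈ Finset.range (k + 1), poissonDefect lam s i * p (k - i) := by
    simp_rw [poissonDefect, sub_mul, Finset.sum_sub_distrib, h0, expShift, Finset.mul_sum]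
    congr 1
    refine Finset.sum_congr rfl fun i hi => ?_
    rw [iterate_backShift p (Finset.mem_range_succ_iff.1 hi)]
    ring
  rw [shiftOp, toeplitz]
  simp_rw [h2, shiftCoeff, add_mul, Finset.sum_add_distrib]
  rw [integral_finsetSum _ fun i _ => (f.integrable_poissonDefect hlam i).mul_const _]
  simp_rw [integral_mul_const, mul_assoc, ← Finset.mul_sum, sub_mul, Finset.sum_sub_distrib, h0, h1]

theorem summable_abs_sum_shiftCoeff {ι : Type*} (s : Finset ι) (f : ι → BernsteinFn) {lam : ℝ}
    (hlam : 0 ≤ lam) : Summable fun i => |∑ j ∈ s, (f j).shiftCoeff lam i| :=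
  Summable.of_nonneg_of_le (fun _ => abs_nonneg _) (fun _ => Finset.abs_sum_le_sum_abs _ _)
    (summable_sum fun j _ => (f j).summable_abs_shiftCoeff hlam)

theorem sum_toeplitz {ι : Type*} (s : Finset ι) (a : ι → ℕ → ℝ) (p : ℕ → ℝ) (k : ℕ) :
    ∑ j ∈ s, toeplitz (a j) p k = toeplitz (fun i => ∑ j ∈ s, a j i) p k := by
  simp_rw [toeplitz, Finset.sum_mul]
  exact Finset.sum_comm

/-! ### Convolution powers -/

/-- The first column of the `m`-th power of the Toeplitz matrix with coefficients `a`, that is, the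
coefficients of the `m`-th power of the power series `∑ a_i u^i`. -/
noncomputable def convPow (a : ℕ → ℝ) (m k : ℕ) : ℝ :=
  PowerSeries.coeff k (PowerSeries.mk a ^ m)

theorem convPow_zero (a : ℕ → ℝ) (k : ℕ) : convPow a 0 k = if k = 0 then 1 else 0 := by
  rw [convPow, pow_zero, PowerSeries.coeff_one]

theorem convPow_succ_eq_sum (a : ℕ → ℝ) (m k : ℕ) :
    convPow a (m + 1) k = ∑ x ∈ Finset.HasAntidiagonal.antidiagonal k, a x.1 * convPow a m x.2 := by
  simp_rw [convPow, pow_succ', PowerSeries.coeff_mul, PowerSeries.coeff_mk]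

theorem convPow_succ (a : ℕ → ℝ) (m k : ℕ) :
    convPow a (m + 1) k = toeplitz a (convPow a m) k := by
  rw [convPow_succ_eq_sum, toeplitz,
    Finset.Nat.sum_antidiagonal_eq_sum_range_succ (fun i j => a i * convPow a m j)]

section convPow

variable {a : ℕ → ℝ}

theorem summable_abs_convPow_and_tsum_le (ha : Summable fun i => |a i|) (m : ℕ) :
    (Summable fun k => |convPow a m k|) ∧ ∑' k, |convPow a m k| ≤ (∑' i, |a i|) ^ m := by
  induction m with
  | zero =>
    have h0 : HasSum (fun k => |convPow a 0 k|) 1 := by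
      refine (hasSum_ite_eq 0 (1 : ℝ)).congr_fun fun k => ?_
      rw [convPow_zero]
      split_ifs <;> simp
    exact ⟨h0.summable, by rw [h0.tsum_eq, pow_zero]⟩
  | succ m ih =>
    have hle (k : ℕ) : |convPow a (m + 1) k| ≤
        ∑ x ∈ Finset.HasAntidiagonal.antidiagonal k, |a x.1| * |convPow a m x.2| := by
      rw [convPow_succ_eq_sum]
      exact (Finset.abs_sum_le_sum_abs _ _).trans_eq (by simp_rw [abs_mul])
    have ha' : Summable fun i => ‖|a i|‖ := by simpa using ha
    have hc' : Summable fun i => ‖|convPow a m i|‖ := by simpa using ih.1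
    have hs := (summable_norm_sum_mul_antidiagonal_of_summable_norm ha' hc').of_norm
    have hs' := Summable.of_nonneg_of_le (fun k => abs_nonneg _) hle hs
    refine ⟨hs', (hs'.tsum_le_tsum hle hs).trans ?_⟩
    rw [← tsum_mul_tsum_eq_tsum_sum_antidiagonal_of_summable_norm ha' hc', pow_succ']
    exact mul_le_mul_of_nonneg_left ih.2 (tsum_nonneg fun _ => abs_nonneg _)

theorem abs_convPow_le (ha : Summable fun i => |a i|) (m k : ℕ) :
    |convPow a m k| ≤ (∑' i, |a i|) ^ m :=
  ((summable_abs_convPow_and_tsum_le ha m).1.le_tsum k fun _ _ => abs_nonneg _).trans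
    (summable_abs_convPow_and_tsum_le ha m).2

theorem norm_mul_pow_le_abs (x : ℝ) {u : ℝ} (hu : |u| ≤ 1) (k : ℕ) : ‖x * u ^ k‖ ≤ |x| := by
  rw [norm_mul, norm_pow, Real.norm_eq_abs, Real.norm_eq_abs]
  exact mul_le_of_le_one_right (abs_nonneg _) (pow_le_one₀ (abs_nonneg _) hu)

theorem hasSum_convPow_mul_pow (ha : Summable fun i => |a i|) {u w : ℝ} (hu : |u| ≤ 1)
    (hw : HasSum (fun i => a i * u ^ i) w) (m : ℕ) :
    HasSum (fun k => convPow a m k * u ^ k) (w ^ m) := by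
  have hs (m : ℕ) : Summable fun k => ‖convPow a m k * u ^ k‖ :=
    Summable.of_nonneg_of_le (fun k => norm_nonneg _) (fun k => norm_mul_pow_le_abs _ hu k)
      (summable_abs_convPow_and_tsum_le ha m).1
  induction m with
  | zero =>
    refine (hasSum_ite_eq 0 (1 : ℝ)).congr_fun fun k => ?_
    rw [convPow_zero]
    split_ifs with hk <;> simp [hk]
  | succ m ih =>
    have ha' : Summable fun i => ‖a i * u ^ i‖ :=
      Summable.of_nonneg_of_le (fun k => norm_nonneg _) (fun k => norm_mul_pow_le_abs _ hu k) ha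
    rw [pow_succ', ← ih.tsum_eq, ← hw.tsum_eq,
      tsum_mul_tsum_eq_tsum_sum_antidiagonal_of_summable_norm ha' (hs m)]
    rw [tsum_congr fun k => show _ = convPow a (m + 1) k * u ^ k from ?_]
    · exact (hs (m + 1)).of_norm.hasSum
    rw [convPow_succ_eq_sum, Finset.sum_mul]
    refine Finset.sum_congr rfl fun x hx => ?_
    rw [← Finset.HasAntidiagonal.mem_antidiagonal.1 hx, pow_add]
    ring

/-! ### The solution of the fractional Cauchy problem -/

/-- The first column of `E_{ν,1}(-t^ν A)`, where `A` is the Toeplitz matrix with coefficients `a`. -/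
noncomputable def toeplitzSolution (ν : ℝ) (a : ℕ → ℝ) (k : ℕ) (t : ℝ) : ℝ :=
  fracSeries ν (fun m => (-1) ^ m * convPow a m k) t

theorem toeplitzSolution_zero {ν : ℝ} (hν : 0 < ν) (k : ℕ) :
    toeplitzSolution ν a k 0 = if k = 0 then 1 else 0 := by
  rw [toeplitzSolution, fracSeries, tsum_eq_single 0]
  · simp [convPow_zero]
  · intro m hm
    rw [Real.zero_rpow (by positivity), zero_div, mul_zero]

theorem abs_neg_one_pow_mul_convPow_le (ha : Summable fun i => |a i|) (k m : ℕ) :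
    |(-1) ^ m * convPow a m k| ≤ 1 * (∑' i, |a i|) ^ m := by
  rw [abs_mul, abs_pow, abs_neg, abs_one, one_pow, one_mul, one_mul]
  exact abs_convPow_le ha m k

theorem hasCaputoDerivAt_toeplitzSolution {ν : ℝ} (hν : ν ∈ Ioo (0 : ℝ) 1)
    (ha : Summable fun i => |a i|) (k : ℕ) {t : ℝ} (ht : 0 < t) :
    HasCaputoDerivAt ν (toeplitzSolution ν a k)
      (-toeplitz a (fun i => toeplitzSolution ν a i t) k) t := by
  have hB : 0 ≤ ∑' i, |a i| := tsum_nonneg fun _ => abs_nonneg _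
  have hd (k : ℕ) := abs_neg_one_pow_mul_convPow_le ha k
  have h := hasCaputoDerivAt_fracSeries hν zero_le_one hB (hd k) ht
  suffices hval : -toeplitz a (fun i => toeplitzSolution ν a i t) k =
      fracSeries ν (fun m => (-1) ^ (m + 1) * convPow a (m + 1) k) t by
    rw [hval]
    exact h
  simp only [toeplitz, toeplitzSolution, fracSeries, ← tsum_mul_left]
  rw [← Summable.tsum_finsetSum fun i _ =>
    (summable_fracSeries hν.1 zero_le_one hB (hd (k - i)) ht.le).mul_left _, ← tsum_neg]
  refine tsum_congr fun m => ?_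
  rw [convPow_succ, toeplitz, Finset.mul_sum, Finset.sum_mul, ← Finset.sum_neg_distrib]
  refine Finset.sum_congr rfl fun i _ => ?_
  rw [pow_succ]
  ring

theorem eq_of_hasCaputoDerivAt_toeplitz {ν : ℝ} (hν : ν ∈ Ioo (0 : ℝ) 1) {q r : ℕ → ℝ → ℝ}
    (h0 : ∀ k, q k 0 = r k 0)
    (hq : ∀ k t, 0 < t → HasCaputoDerivAt ν (q k) (-toeplitz a (fun i => q i t) k) t)
    (hr : ∀ k t, 0 < t → HasCaputoDerivAt ν (r k) (-toeplitz a (fun i => r i t) k) t)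
    (k : ℕ) {t : ℝ} (ht : 0 ≤ t) : q k t = r k t := by
  -- the system is triangular, so the entries can be treated one after the other
  induction k using Nat.strong_induction_on generalizing t with
  | _ k ih =>
    refine sub_eq_zero.1 (eq_zero_of_hasCaputoDerivAt_mul (g := fun s => q k s - r k s) hν (-a 0)
      (fun s hs => ?_) (sub_eq_zero.2 (h0 k)) ht)
    convert (hq k s hs).sub (hr k s hs) hs using 1
    simp only [toeplitz, Finset.sum_range_succ', Nat.sub_zero]
    rw [Finset.sum_congr rfl fun i hi => by
      rw [ih (k - (i + 1)) (by have := Finset.mem_range.1 hi; omega) hs.le]]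
    ring

theorem mittagLeffler_neg_rpow_mul {ν t : ℝ} (ht : 0 ≤ t) (w : ℝ) :
    mittagLeffler ν 1 (-(t ^ ν * w)) = fracSeries ν (fun m => (-w) ^ m) t := by
  refine tsum_congr fun m => ?_
  rw [Real.rpow_mul_natCast ht, neg_mul_eq_mul_neg, mul_pow]
  ring

/-- The generating function of `toeplitzSolution`: a Fubini argument, as `u ↦ ∑ a_i u^i` turns
convolution powers into powers. -/
theorem hasSum_toeplitzSolution_mul_pow {ν : ℝ} (hν : 0 < ν) (ha : Summable fun i => |a i|)
    {u w : ℝ} (hu : |u| ≤ 1) (hw : HasSum (fun i => a i * u ^ i) w) {t : ℝ} (ht : 0 ≤ t) :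
    HasSum (fun k => toeplitzSolution ν a k t * u ^ k) (mittagLeffler ν 1 (-(t ^ ν * w))) := by
  set e : ℕ → ℝ := fun m => t ^ (ν * m) / Real.Gamma (ν * m + 1) with he
  have he0 (m : ℕ) : 0 ≤ e m := by
    have := Real.Gamma_pos_of_pos (show 0 < ν * m + 1 by positivity)
    positivity
  let F : ℕ × ℕ → ℝ := fun x => (-1) ^ x.1 * convPow a x.1 x.2 * e x.1 * u ^ x.2
  have hFle (m k : ℕ) : ‖F (m, k)‖ ≤ |convPow a m k| * e m := by
    simp only [F, norm_mul, norm_pow, norm_neg, norm_one, one_pow, one_mul, Real.norm_eq_abs]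
    rw [abs_of_nonneg (he0 m)]
    refine mul_le_of_le_one_right (by have := he0 m; positivity) (pow_le_one₀ (abs_nonneg _) hu)
  have hG : Summable fun x : ℕ × ℕ => |convPow a x.1 x.2| * e x.1 := by
    refine (summable_prod_of_nonneg (f := fun x : ℕ × ℕ => |convPow a x.1 x.2| * e x.1)
      fun x => mul_nonneg (abs_nonneg _) (he0 _)).2
      ⟨fun m => (summable_abs_convPow_and_tsum_le ha m).1.mul_right (e m), ?_⟩
    simp only [tsum_mul_right]
    refine Summable.of_nonneg_of_le (fun m => mul_nonneg (tsum_nonneg fun _ => abs_nonneg _)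
      (he0 m)) (fun m => mul_le_mul_of_nonneg_right (summable_abs_convPow_and_tsum_le ha m).2
      (he0 m)) ?_
    simpa using summable_fracSeries_bound hν 1 (∑' i, |a i|) ht
  have hF : Summable F := Summable.of_norm_bounded hG (by rintro ⟨m, k⟩; exact hFle m k)
  have hrow (m : ℕ) : HasSum (fun k => F (m, k)) ((-w) ^ m * e m) := by
    have h := (hasSum_convPow_mul_pow ha hu hw m).mul_left ((-1) ^ m * e m)
    rw [neg_pow, show (-1) ^ m * w ^ m * e m = (-1) ^ m * e m * w ^ m by ring]
    exact h.congr_fun fun k => by simp only [F]; ring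
  have htot : HasSum F (mittagLeffler ν 1 (-(t ^ ν * w))) := by
    rw [mittagLeffler_neg_rpow_mul ht, fracSeries]
    exact (hF.hasSum.prod_fiberwise hrow).tsum_eq ▸ hF.hasSum
  refine ((Equiv.prodComm ℕ ℕ).hasSum_iff.2 htot).prod_fiberwise fun k => ?_
  have hcol := (hF.comp_injective (Equiv.prodComm ℕ ℕ).injective).prod_factor k
  simp only [toeplitzSolution, fracSeries, ← tsum_mul_right]
  exact hcol.hasSum

end convPow

/-- Uniqueness of power series coefficients. -/
theorem eq_of_hasSum_mul_pow {x y : ℕ → ℝ} {F : ℝ → ℝ}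
    (hx : ∀ u, |u| ≤ 1 → HasSum (fun k => x k * u ^ k) (F u))
    (hy : ∀ u, |u| ≤ 1 → HasSum (fun k => y k * u ^ k) (F u)) : x = y := by
  have key (z : ℕ → ℝ) (hz : ∀ u, |u| ≤ 1 → HasSum (fun k => z k * u ^ k) (F u)) :
      HasFPowerSeriesAt F (FormalMultilinearSeries.ofScalars ℝ z) 0 := by
    rw [hasFPowerSeriesAt_iff]
    filter_upwards [Metric.closedBall_mem_nhds (0 : ℝ) one_pos] with u hu
    simpa [mul_comm, FormalMultilinearSeries.coeff_ofScalars] using hz u (by simpa using hu)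
  have h := (key x hx).eq_formalMultilinearSeries (key y hy)
  ext k
  have := congrArg (fun p => FormalMultilinearSeries.coeff p k) h
  simpa [FormalMultilinearSeries.coeff_ofScalars] using this

/-! ### Laplace transforms determine measures -/

/-- The function `x ↦ e^{-x}` as a bounded continuous function on `[0, ∞)`. -/
noncomputable def expNegBCF : ℝ≥0 →ᵇ ℝ :=
  BoundedContinuousFunction.ofNormedAddCommGroup (fun x : ℝ≥0 => Real.exp (-x)) (by fun_prop) 1
    fun x => by
      rw [Real.norm_of_nonneg (Real.exp_pos _).le]
      exact Real.exp_le_one_iff.2 (neg_nonpos.2 x.2)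

theorem MeasureTheory.Measure.ext_of_integral_exp_neg_nat {μ₁ μ₂ : Measure ℝ≥0} [IsFiniteMeasure μ₁]
    [IsFiniteMeasure μ₂]
    (h : ∀ n : ℕ, ∫ x : ℝ≥0, Real.exp (-(n * x : ℝ)) ∂μ₁ = ∫ x : ℝ≥0, Real.exp (-(n * x : ℝ)) ∂μ₂) :
    μ₁ = μ₂ := by
  -- the polynomials in `e^{-x}` form an algebra that separates points
  let A : StarSubalgebra ℝ (ℝ≥0 →ᵇ ℝ) :=
    { Algebra.adjoin ℝ {expNegBCF} with
      star_mem' := fun {a} ha => by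
        have : star a = a := by ext x; simp
        rw [this]
        exact ha }
  refine ext_of_forall_mem_subalgebra_integral_eq_of_polish (A := A) (𝕜 := ℝ) ?_ fun g hg => ?_
  · intro x y hxy
    refine ⟨_, ⟨_, ⟨expNegBCF, Algebra.subset_adjoin rfl, rfl⟩, rfl⟩, ?_⟩
    change Real.exp (-x) ≠ Real.exp (-y)
    simpa using hxy
  · have hg' : g ∈ Algebra.adjoin ℝ {expNegBCF} := hg
    rw [Algebra.adjoin_singleton_eq_range_aeval] at hg'
    obtain ⟨p, rfl⟩ := hg'
    have hval (x : ℝ≥0) : (Polynomial.aeval expNegBCF p : ℝ≥0 →ᵇ ℝ) x =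
        ∑ n ∈ Finset.range (p.natDegree + 1), p.coeff n * Real.exp (-(n * x : ℝ)) := by
      rw [Polynomial.aeval_eq_sum_range, BoundedContinuousFunction.sum_apply]
      refine Finset.sum_congr rfl fun n _ => ?_
      rw [neg_mul_eq_mul_neg, Real.exp_nat_mul]
      rfl
    have hint (μ : Measure ℝ≥0) [IsFiniteMeasure μ] (n : ℕ) :
        Integrable (fun x : ℝ≥0 => Real.exp (-(n * x : ℝ))) μ := by
      refine Integrable.of_bound (by fun_prop) 1 (ae_of_all _ fun x => ?_)
      rw [Real.norm_of_nonneg (Real.exp_pos _).le]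
      exact Real.exp_le_one_iff.2 (neg_nonpos.2 (by positivity))
    change ∫ x, (Polynomial.aeval expNegBCF p : ℝ≥0 →ᵇ ℝ) x ∂μ₁ =
      ∫ x, (Polynomial.aeval expNegBCF p : ℝ≥0 →ᵇ ℝ) x ∂μ₂
    simp_rw [hval]
    rw [integral_finsetSum _ fun n _ => (hint μ₁ n).const_mul _,
      integral_finsetSum _ fun n _ => (hint μ₂ n).const_mul _]
    simp_rw [integral_const_mul, h]

/-! ### Processes at independent random times -/

/-- The least point of the grid `{1/(n+1), 2/(n+1), …}` strictly above `x`. -/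
noncomputable def gridAbove (n : ℕ) (x : ℝ≥0) : ℝ≥0 :=
  (⌊(n + 1) * x⌋₊ + 1 : ℕ) / (n + 1)

theorem lt_gridAbove (n : ℕ) (x : ℝ≥0) : x < gridAbove n x := by
  rw [gridAbove, lt_div_iff₀ (by positivity), mul_comm]
  exact_mod_cast Nat.lt_floor_add_one _

theorem gridAbove_le (n : ℕ) (x : ℝ≥0) : gridAbove n x ≤ x + 1 / (n + 1) := by
  have h := Nat.floor_le (show 0 ≤ ((n : ℝ≥0) + 1) * x from zero_le)
  rw [gridAbove, div_le_iff₀ (by positivity), add_mul x,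
    div_mul_cancel₀ _ (by positivity)]
  push_cast
  rw [mul_comm x]
  gcongr

theorem tendsto_gridAbove (x : ℝ≥0) : Tendsto (fun n => gridAbove n x) atTop (𝓝[≥] x) := by
  refine tendsto_nhdsWithin_iff.2 ⟨?_, Eventually.of_forall fun n => (lt_gridAbove n x).le⟩
  have h : Tendsto (fun n : ℕ => x + 1 / ((n : ℝ≥0) + 1)) atTop (𝓝 (x + 0)) :=
    tendsto_const_nhds.add tendsto_one_div_add_atTop_nhds_zero_nat
  rw [add_zero] at h
  exact tendsto_of_tendsto_of_tendsto_of_le_of_le tendsto_const_nhds h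
    (fun n => (lt_gridAbove n x).le) fun n => gridAbove_le n x

section RandomTime

variable {Ω E : Type*} [MeasurableSpace Ω] {P : Measure Ω} [MeasurableSpace E]

theorem measurable_apply_comp_nat {Y : ℝ≥0 → Ω → E} (hY : ∀ t, Measurable (Y t)) (c : ℕ → ℝ≥0)
    {κ : Ω → ℕ} (hκ : Measurable κ) : Measurable fun ω => Y (c (κ ω)) ω :=
  (measurable_from_prod_countable_right (f := fun p : ℕ × Ω => Y (c p.1) p.2)
    fun k => hY (c k)).comp (hκ.prodMk measurable_id)

theorem measurable_gridIndex (n : ℕ) : Measurable fun x : ℝ≥0 => ⌊((n : ℝ≥0) + 1) * x⌋₊ :=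
  Nat.measurable_floor.comp (by fun_prop)

theorem aemeasurable_apply_comp [TopologicalSpace E] [TopologicalSpace.PseudoMetrizableSpace E]
    [BorelSpace E] {Y : ℝ≥0 → Ω → E} (hY : ∀ t, Measurable (Y t))
    (hc : ∀ᵐ ω ∂P, ∀ t, ContinuousWithinAt (fun s => Y s ω) (Ici t) t)
    {τ : Ω → ℝ≥0} (hτ : AEMeasurable τ P) : AEMeasurable (fun ω => Y (τ ω) ω) P := by
  refine aemeasurable_of_tendsto_metrizable_ae atTop
    (f := fun n ω => Y (gridAbove n (hτ.mk τ ω)) ω) (fun n => ?_) ?_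
  · exact (measurable_apply_comp_nat hY (fun k => ((k + 1 : ℕ) : ℝ≥0) / (n + 1))
      ((measurable_gridIndex n).comp hτ.measurable_mk)).aemeasurable
  · filter_upwards [hc, hτ.ae_eq_mk] with ω hω hτω
    rw [← hτω]
    exact (hω (τ ω)).tendsto.comp (tendsto_gridAbove (τ ω))

/-- Independence passes to almost sure limits of functionals of `Z`. The limit need not be a measurable
functional of `Z`, but it almost surely coincides with the `limsup`, which is one. -/
theorem indepFun_and_aemeasurable_of_tendsto {X : Ω → E} {F : Type*} [MeasurableSpace F] {Z : Ω → F}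
    (hZ : Measurable Z) (hind : IndepFun X Z P) {g : ℕ → F → ℝ≥0} (hg : ∀ n, Measurable (g n))
    {τ : Ω → ℝ≥0} (hlim : ∀ᵐ ω ∂P, Tendsto (fun n => g n (Z ω)) atTop (𝓝 (τ ω))) :
    IndepFun X τ P ∧ AEMeasurable τ P := by
  have hm : Measurable fun z => limsup (fun n => g n z) atTop := Measurable.limsup hg
  have hae : (fun z => limsup (fun n => g n z) atTop) ∘ Z =ᵐ[P] τ := by
    filter_upwards [hlim] with ω hω
    exact hω.limsup_eq
  exact ⟨(hind.comp measurable_id hm).congr ae_eq_rfl hae,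
    (hm.comp hZ).aemeasurable.congr hae⟩

variable [IsProbabilityMeasure P]

theorem integral_apply_comp_nat {Y : ℝ≥0 → Ω → E} (hY : ∀ t, Measurable (Y t)) (c : ℕ → ℝ≥0)
    {κ : Ω → ℕ} (hκ : Measurable κ) (hind : ∀ t, IndepFun (Y t) κ P) {φ : E → ℝ}
    (hφ : Measurable φ) {M : ℝ} (hM : ∀ x, ‖φ x‖ ≤ M) :
    ∫ ω, φ (Y (c (κ ω)) ω) ∂P = ∫ ω, (∫ ω', φ (Y (c (κ ω)) ω') ∂P) ∂P := by
  have hU : (⋃ k, κ ⁻¹' {k}) = univ := by ext ω; simp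
  have hms (k : ℕ) : MeasurableSet (κ ⁻¹' {k}) := hκ (measurableSet_singleton k)
  have hdisj : Pairwise (Function.onFun Disjoint fun k => κ ⁻¹' {k}) := fun i j hij =>
    Disjoint.preimage _ (by simpa using hij)
  have h1 : Integrable (fun ω => φ (Y (c (κ ω)) ω)) P :=
    Integrable.of_bound (hφ.comp (measurable_apply_comp_nat hY c hκ)).aestronglyMeasurable M
      (ae_of_all _ fun ω => hM _)
  have h2 : Integrable (fun ω => ∫ ω', φ (Y (c (κ ω)) ω') ∂P) P := by
    refine Integrable.of_bound ((measurable_from_nat (f := fun k => ∫ ω', φ (Y (c k) ω') ∂P)).comp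
      hκ).aestronglyMeasurable M (ae_of_all _ fun ω => ?_)
    simpa using norm_integral_le_of_norm_le_const (μ := P) (ae_of_all _ fun ω' => hM (Y (c (κ ω)) ω'))
  rw [← setIntegral_univ, ← hU, integral_iUnion hms hdisj h1.integrableOn,
    ← setIntegral_univ (f := fun ω => ∫ ω', φ (Y (c (κ ω)) ω') ∂P), ← hU,
    integral_iUnion hms hdisj h2.integrableOn]
  refine tsum_congr fun k => ?_
  have hL : ∫ ω in κ ⁻¹' {k}, φ (Y (c (κ ω)) ω) ∂P = ∫ ω in κ ⁻¹' {k}, φ (Y (c k) ω) ∂P :=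
    setIntegral_congr_fun (hms k) fun ω (hω : κ ω = k) => by simp only [hω]
  have hR : ∫ ω in κ ⁻¹' {k}, (∫ ω', φ (Y (c (κ ω)) ω') ∂P) ∂P =
      ∫ ω in κ ⁻¹' {k}, (∫ ω', φ (Y (c k) ω') ∂P) ∂P :=
    setIntegral_congr_fun (hms k) fun ω (hω : κ ω = k) => by simp only [hω]
  have hi := ((hind (c k)).comp hφ (measurable_from_nat
    (f := fun j : ℕ => if j = k then (1 : ℝ) else 0))).integral_mul_eq_mul_integral
    (hφ.comp (hY _)).aestronglyMeasurable (measurable_from_nat.comp hκ).aestronglyMeasurable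
  have h3 : (fun j : ℕ => if j = k then (1 : ℝ) else 0) ∘ κ = (κ ⁻¹' {k}).indicator 1 := by
    ext ω
    by_cases hω : ω ∈ κ ⁻¹' {k}
    · rw [indicator_of_mem hω]
      simpa using hω
    · rw [indicator_of_notMem hω]
      simpa using hω
  rw [h3, integral_indicator_one (hms k)] at hi
  rw [hL, hR, setIntegral_const, smul_eq_mul, mul_comm, ← integral_indicator (hms k)]
  refine Eq.trans (integral_congr_ae (ae_of_all _ fun ω => ?_)) hi
  by_cases hω : ω ∈ κ ⁻¹' {k}
  · simp [indicator_of_mem hω]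
  · simp [indicator_of_notMem hω]

/-- A right-continuous process evaluated at an independent random time: conditionally on `τ = t` it
is distributed like `Y t`. Only the one-dimensional marginals of `Y` need to be independent of `τ`. -/
theorem integral_apply_comp [TopologicalSpace E] [TopologicalSpace.PseudoMetrizableSpace E]
    [BorelSpace E] {Y : ℝ≥0 → Ω → E} (hY : ∀ t, Measurable (Y t))
    (hc : ∀ᵐ ω ∂P, ∀ t, ContinuousWithinAt (fun s => Y s ω) (Ici t) t)
    {τ : Ω → ℝ≥0} (hτ : AEMeasurable τ P) (hind : ∀ t, IndepFun (Y t) τ P) {φ : E → ℝ}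
    (hφ : Continuous φ) {M : ℝ} (hM : ∀ x, ‖φ x‖ ≤ M) :
    ∫ ω, φ (Y (τ ω) ω) ∂P = ∫ ω, (∫ ω', φ (Y (τ ω) ω') ∂P) ∂P := by
  set τ' := hτ.mk τ with hτ'
  have hψ (x : ℝ≥0) : ‖∫ ω', φ (Y x ω') ∂P‖ ≤ M := by
    simpa using norm_integral_le_of_norm_le_const (μ := P) (ae_of_all _ fun ω' => hM (Y x ω'))
  have hψlim (x : ℝ≥0) : Tendsto (fun n => ∫ ω', φ (Y (gridAbove n x) ω') ∂P) atTop
      (𝓝 (∫ ω', φ (Y x ω') ∂P)) := by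
    refine tendsto_integral_of_dominated_convergence (fun _ => M)
      (fun n => (hφ.measurable.comp (hY _)).aestronglyMeasurable) (integrable_const _)
      (fun n => ae_of_all _ fun ω => hM _) ?_
    filter_upwards [hc] with ω hω
    exact (hφ.tendsto _).comp ((hω x).tendsto.comp (tendsto_gridAbove x))
  have hl : Tendsto (fun n => ∫ ω, φ (Y (gridAbove n (τ' ω)) ω) ∂P) atTop
      (𝓝 (∫ ω, φ (Y (τ ω) ω) ∂P)) := by
    refine tendsto_integral_of_dominated_convergence (fun _ => M)
      (fun n => ?_) (integrable_const _) (fun n => ae_of_all _ fun ω => hM _) ?_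
    · exact (hφ.measurable.comp (measurable_apply_comp_nat hY
        (fun k => ((k + 1 : ℕ) : ℝ≥0) / (n + 1))
        ((measurable_gridIndex n).comp hτ.measurable_mk))).aestronglyMeasurable
    · filter_upwards [hc, hτ.ae_eq_mk] with ω hω hτω
      rw [hτ', ← hτω]
      exact (hφ.tendsto _).comp ((hω (τ ω)).tendsto.comp (tendsto_gridAbove (τ ω)))
  have hr : Tendsto (fun n => ∫ ω, (∫ ω', φ (Y (gridAbove n (τ' ω)) ω') ∂P) ∂P) atTop
      (𝓝 (∫ ω, (∫ ω', φ (Y (τ ω) ω') ∂P) ∂P)) := by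
    refine tendsto_integral_of_dominated_convergence (fun _ => M)
      (fun n => ?_) (integrable_const _) (fun n => ae_of_all _ fun ω => hψ _) ?_
    · exact ((measurable_from_nat
        (f := fun k => ∫ ω', φ (Y (((k + 1 : ℕ) : ℝ≥0) / (n + 1)) ω') ∂P)).comp
        ((measurable_gridIndex n).comp hτ.measurable_mk)).aestronglyMeasurable
    · filter_upwards [hτ.ae_eq_mk] with ω hτω
      rw [hτ', ← hτω]
      exact hψlim _
  refine tendsto_nhds_unique hl (hr.congr fun n => ?_)
  refine (integral_apply_comp_nat hY (fun k => ((k + 1 : ℕ) : ℝ≥0) / (n + 1))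
    ((measurable_gridIndex n).comp hτ.measurable_mk) (fun t => ?_) hφ.measurable hM).symm
  exact ((hind t).congr ae_eq_rfl hτ.ae_eq_mk).comp measurable_id (measurable_gridIndex n)

end RandomTime

/-! ### Hitting times of paths -/

/-- The least index `k` such that the path `x` has reached the level `t` at time `k / (n + 1)`. -/
noncomputable def hitIndex (n : ℕ) (t : ℝ≥0) (x : ℝ≥0 → ℝ≥0) : ℕ :=
  sInf {k : ℕ | t ≤ x (k / (n + 1))}

theorem measurable_hitIndex (n : ℕ) (t : ℝ≥0) : Measurable (hitIndex n t) := by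
  have hm (k : ℕ) : MeasurableSet {x : ℝ≥0 → ℝ≥0 | t ≤ x (k / (n + 1))} :=
    measurableSet_le measurable_const (measurable_pi_apply _)
  refine measurable_of_Iic fun j => ?_
  -- `sInf s ≤ j` if `s` has an element `≤ j`, or if `s` is empty, as `sInf ∅ = 0`
  have : hitIndex n t ⁻¹' Iic j = (⋃ k ∈ Iic j, {x | t ≤ x (k / (n + 1))}) ∪
      ⋂ k : ℕ, {x | t ≤ x (k / (n + 1))}ᶜ := by
    ext x
    simp only [mem_preimage, mem_Iic, mem_union, mem_iUnion, mem_iInter, mem_ofPred_eq, mem_compl_iff,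
      exists_prop, hitIndex]
    rcases Set.eq_empty_or_nonempty {k : ℕ | t ≤ x (k / (n + 1))} with h | h
    · rw [h, Nat.sInf_empty]
      simp only [zero_le, true_iff]
      exact Or.inr fun k hk => (eq_empty_iff_forall_notMem.1 h) k hk
    · constructor
      · exact fun hj => Or.inl ⟨_, hj, Nat.sInf_mem h⟩
      · rintro (⟨k, hkj, hk⟩ | hall)
        · exact (Nat.sInf_le hk).trans hkj
        · obtain ⟨k, hk⟩ := h
          exact absurd hk (hall k)
  rw [this]
  exact (MeasurableSet.biUnion (to_countable _) fun k _ => hm k).union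
    (MeasurableSet.iInter fun k => (hm k).compl)

section Path

variable {x : ℝ≥0 → ℝ≥0} {t : ℝ≥0}

theorem tendsto_hitIndex_div (hx : Monotone x) (hub : ∃ s, t ≤ x s) :
    Tendsto (fun n => (hitIndex n t x : ℝ≥0) / (n + 1)) atTop (𝓝[≥] sInf {s | t ≤ x s}) := by
  set L := sInf {s | t ≤ x s} with hL
  -- the grid point above `L` has been passed by the hitting set, which is an up-set
  have hgrid (n : ℕ) : t ≤ x ((⌊((n : ℝ≥0) + 1) * L⌋₊ + 1 : ℕ) / (n + 1)) := by
    obtain ⟨s, hs, hsL⟩ := exists_lt_of_csInf_lt hub (lt_gridAbove n L)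
    exact le_trans hs (hx hsL.le)
  have hlow (n : ℕ) : L ≤ (hitIndex n t x : ℝ≥0) / (n + 1) :=
    csInf_le (OrderBot.bddBelow _) (Nat.sInf_mem (s := {k : ℕ | t ≤ x (k / (n + 1))}) ⟨_, hgrid n⟩)
  have hupp (n : ℕ) : (hitIndex n t x : ℝ≥0) / (n + 1) ≤ gridAbove n L := by
    rw [gridAbove]
    gcongr
    exact Nat.sInf_le (hgrid n)
  refine tendsto_nhdsWithin_iff.2 ⟨?_, Eventually.of_forall hlow⟩
  exact tendsto_of_tendsto_of_tendsto_of_le_of_le tendsto_const_nhds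
    (tendsto_nhds_of_tendsto_nhdsWithin (tendsto_gridAbove L)) hlow hupp

/-- Right-continuity makes the set of times at or after the level `t` is reached closed. -/
theorem sInf_hitting_le_iff (hx : Monotone x) (hc : ∀ s, ContinuousWithinAt x (Ici s) s)
    (hub : ∃ s, t ≤ x s) (s : ℝ≥0) : sInf {s | t ≤ x s} ≤ s ↔ t ≤ x s := by
  refine ⟨fun h => ?_, fun h => csInf_le (OrderBot.bddBelow _) h⟩
  have hlim : Tendsto (fun n => x (gridAbove n s)) atTop (𝓝 (x s)) :=
    (hc s).tendsto.comp (tendsto_gridAbove s)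
  refine ge_of_tendsto' hlim fun n => ?_
  obtain ⟨r, hr, hrs⟩ := exists_lt_of_csInf_lt hub (h.trans_lt (lt_gridAbove n s))
  exact le_trans hr (hx hrs.le)

end Path

/-! ### Stable subordinators and their inverses -/

section Stable

variable {Ω : Type*} [MeasurableSpace Ω] {P : Measure Ω} [IsProbabilityMeasure P]
  {S : ℝ≥0 → Ω → ℝ≥0} {φ : ℝ → ℝ}

theorem integrable_exp_neg_mul {X : Ω → ℝ≥0} (hX : Measurable X) {z : ℝ} (hz : 0 ≤ z) :
    Integrable (fun ω => Real.exp (-(z * X ω))) P := by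
  refine Integrable.of_bound (by fun_prop) 1 (ae_of_all _ fun ω => ?_)
  rw [Real.norm_of_nonneg (Real.exp_pos _).le]
  exact Real.exp_le_one_iff.2 (neg_nonpos.2 (by positivity))

/-- A Chernoff bound. With `s → ∞` it shows that the paths are unbounded, so that the set of hitting
times in `inverseProcess` is nonempty; with `z → ∞` that a stable `S 1` is positive. -/
theorem IsSubordinator.measureReal_le_le (hS : IsSubordinator S φ P) (s T z : ℝ≥0) :
    P.real {ω | S s ω ≤ T} ≤ Real.exp (z * T - s * φ z) := by
  have h := mul_meas_ge_le_integral_of_nonneg (μ := P)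
    (ae_of_all _ fun ω => (Real.exp_pos (-((z : ℝ) * S s ω))).le)
    (integrable_exp_neg_mul (hS.measurable s) z.2) (Real.exp (-(z * T)))
  rw [hS.laplace s z] at h
  rw [sub_eq_add_neg, Real.exp_add]
  have hsub : P.real {ω | S s ω ≤ T} ≤
      P.real {ω | Real.exp (-(z * T : ℝ)) ≤ Real.exp (-((z : ℝ) * S s ω))} := by
    refine measureReal_mono fun ω (hω : S s ω ≤ T) => ?_
    simp only [mem_ofPred_eq, Real.exp_le_exp, neg_le_neg_iff]
    gcongr
  calc P.real {ω | S s ω ≤ T}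
      = Real.exp (z * T) * (Real.exp (-(z * T)) * P.real {ω | S s ω ≤ T}) := by
        rw [← mul_assoc, ← Real.exp_add, add_neg_cancel, Real.exp_zero, one_mul]
    _ ≤ Real.exp (z * T) * Real.exp (-(s * φ z)) := by
        gcongr
        exact le_trans (by gcongr) h

theorem IsSubordinator.ae_exists_le (hS : IsSubordinator S φ P) (hφ : 0 < φ 1) :
    ∀ᵐ ω ∂P, ∀ t, ∃ s, t ≤ S s ω := by
  have h (T : ℕ) : ∀ᵐ ω ∂P, ∃ s, (T : ℝ≥0) ≤ S s ω := by
    have hlim : Tendsto (fun n : ℕ => Real.exp ((1 : ℝ≥0) * (T : ℝ≥0) - (n : ℝ≥0) * φ (1 : ℝ≥0)))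
        atTop (𝓝 0) := by
      simp only [NNReal.coe_one, one_mul, NNReal.coe_natCast]
      refine Real.tendsto_exp_atBot.comp ?_
      exact tendsto_atBot_add_const_left _ _ (tendsto_neg_atTop_atBot.comp
        (tendsto_natCast_atTop_atTop.atTop_mul_const hφ))
    have hle (n : ℕ) : P.real {ω | ¬ ∃ s, (T : ℝ≥0) ≤ S s ω} ≤
        Real.exp ((1 : ℝ≥0) * (T : ℝ≥0) - (n : ℝ≥0) * φ (1 : ℝ≥0)) := by
      refine (measureReal_mono fun ω hω => ?_).trans (hS.measureReal_le_le n T 1)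
      simp only [mem_ofPred_eq, not_exists, not_le] at hω
      exact (hω n).le
    rw [ae_iff, ← measureReal_eq_zero_iff]
    exact le_antisymm (ge_of_tendsto' hlim hle) measureReal_nonneg
  filter_upwards [ae_all_iff.2 h] with ω hω t
  obtain ⟨T, hT⟩ := exists_nat_ge t
  obtain ⟨s, hs⟩ := hω T
  exact ⟨s, hT.trans hs⟩

variable {ν : ℝ}

theorem IsSubordinator.ae_pos (hS : IsSubordinator S (fun x => x ^ ν) P) (hν : 0 < ν) :
    ∀ᵐ ω ∂P, 0 < S 1 ω := by
  have hlim : Tendsto (fun n : ℕ => Real.exp ((n : ℝ≥0) * (0 : ℝ≥0) -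
      (1 : ℝ≥0) * ((n : ℝ≥0) : ℝ) ^ ν)) atTop (𝓝 0) := by
    simp only [NNReal.coe_zero, mul_zero, NNReal.coe_one, one_mul, zero_sub, NNReal.coe_natCast]
    exact Real.tendsto_exp_atBot.comp (tendsto_neg_atTop_atBot.comp
      ((tendsto_rpow_atTop hν).comp tendsto_natCast_atTop_atTop))
  rw [ae_iff, ← measureReal_eq_zero_iff]
  simp only [not_lt]
  exact le_antisymm (ge_of_tendsto' hlim fun n => hS.measureReal_le_le 1 0 n) measureReal_nonneg

/-- Self-similarity of a stable subordinator. -/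
theorem IsSubordinator.map_eq_map_scaled (hS : IsSubordinator S (fun x => x ^ ν) P) (hν : 0 < ν)
    (s : ℝ≥0) : P.map (S s) = P.map (fun ω => s ^ ν⁻¹ * S 1 ω) := by
  have hm := (hS.measurable 1).const_mul (s ^ ν⁻¹)
  have := Measure.isProbabilityMeasure_map (μ := P) (hS.measurable s).aemeasurable
  have := Measure.isProbabilityMeasure_map (μ := P) hm.aemeasurable
  refine Measure.ext_of_integral_exp_neg_nat fun n => ?_
  rw [integral_map (hS.measurable s).aemeasurable (by fun_prop),
    integral_map hm.aemeasurable (by fun_prop)]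
  have h1 := hS.laplace s n
  have h2 := hS.laplace 1 (n * s ^ ν⁻¹)
  simp only [NNReal.coe_mul, NNReal.coe_natCast, NNReal.coe_rpow, NNReal.coe_one, one_mul,
    ← mul_assoc] at h1 h2 ⊢
  rw [h1, h2, Real.mul_rpow (by positivity) (by positivity), ← Real.rpow_mul (by positivity),
    inv_mul_cancel₀ hν.ne', Real.rpow_one, mul_comm]

theorem IsSubordinator.inverseProcess_le_iff (hS : IsSubordinator S φ P) (hφ : 0 < φ 1) :
    ∀ᵐ ω ∂P, ∀ t s, inverseProcess S t ω ≤ s ↔ t ≤ S s ω := by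
  filter_upwards [hS.monotone, hS.rightCont, hS.ae_exists_le hφ] with ω h1 h2 h3 t s
  exact sInf_hitting_le_iff h1 h2 (h3 t) s

theorem IsSubordinator.tendsto_inverseProcess (hS : IsSubordinator S φ P) (hφ : 0 < φ 1) :
    ∀ᵐ ω ∂P, ∀ t, Tendsto (fun n => (hitIndex n t (fun s => S s ω) : ℝ≥0) / (n + 1)) atTop
      (𝓝[≥] inverseProcess S t ω) := by
  filter_upwards [hS.monotone, hS.ae_exists_le hφ] with ω h1 h3 t
  exact tendsto_hitIndex_div h1 (h3 t)

theorem IsSubordinator.aemeasurable_inverseProcess (hS : IsSubordinator S φ P) (hφ : 0 < φ 1)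
    (t : ℝ≥0) : AEMeasurable (inverseProcess S t) P := by
  refine aemeasurable_of_tendsto_metrizable_ae atTop
    (f := fun n ω => (hitIndex n t (fun s => S s ω) : ℝ≥0) / (n + 1)) (fun n => ?_) ?_
  · have h : Measurable fun ω => hitIndex n t (fun s => S s ω) :=
      (measurable_hitIndex n t).comp (measurable_pi_lambda _ hS.measurable)
    exact ((measurable_from_nat (f := fun k : ℕ => (k : ℝ≥0) / (n + 1))).comp h).aemeasurable
  · filter_upwards [hS.tendsto_inverseProcess hφ] with ω hω
    exact tendsto_nhds_of_tendsto_nhdsWithin (hω t)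

/-- The inverse of a stable subordinator has the law of `(t / S 1) ^ ν`: by self-similarity,
`{L t ≤ s} = {t ≤ S s}` has the probability of `{t ≤ s ^ (1 / ν) S 1}`. -/
theorem IsSubordinator.map_inverseProcess (hS : IsSubordinator S (fun x => x ^ ν) P) (hν : 0 < ν)
    (t : ℝ≥0) : P.map (inverseProcess S t) = P.map (fun ω => (t / S 1 ω) ^ ν) := by
  have h1 : (0 : ℝ) < (1 : ℝ) ^ ν := by simp
  have hL := hS.aemeasurable_inverseProcess h1 t
  have hmeas := hS.measurable
  have hR : Measurable fun ω => (t / S 1 ω) ^ ν := by fun_prop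
  have := Measure.isProbabilityMeasure_map (μ := P) hL
  refine Measure.ext_of_Iic _ _ fun s => ?_
  rw [Measure.map_apply_of_aemeasurable hL measurableSet_Iic, Measure.map_apply hR measurableSet_Iic]
  calc P (inverseProcess S t ⁻¹' Iic s) = P (S s ⁻¹' Ici t) := by
        refine measure_congr ?_
        filter_upwards [hS.inverseProcess_le_iff h1] with ω hω
        exact propext (hω t s)
    _ = P ((fun ω => s ^ ν⁻¹ * S 1 ω) ⁻¹' Ici t) := by
        rw [← Measure.map_apply (hS.measurable s) measurableSet_Ici, hS.map_eq_map_scaled hν,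
          Measure.map_apply ((hS.measurable 1).const_mul _) measurableSet_Ici]
    _ = _ := by
        refine measure_congr ?_
        filter_upwards [hS.ae_pos hν] with ω hω
        refine propext ?_
        change t ≤ s ^ ν⁻¹ * S 1 ω ↔ (t / S 1 ω) ^ ν ≤ s
        rw [← div_le_iff₀ hω, NNReal.le_rpow_inv_iff hν]

/-- The negative moments of `S 1`, from `Γ(a) x^{-a} = ∫ μ^{a-1} e^{-μ x} dμ` and Fubini. -/
theorem IsSubordinator.integral_inv_rpow (hS : IsSubordinator S (fun x => x ^ ν) P) (hν : 0 < ν)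
    {a : ℝ} (ha : 0 < a) :
    Integrable (fun ω => (1 / (S 1 ω : ℝ)) ^ a) P ∧
      ∫ ω, (1 / (S 1 ω : ℝ)) ^ a ∂P = Real.Gamma (a / ν) / (ν * Real.Gamma a) := by
  have hG := Real.Gamma_pos_of_pos ha
  have hmeas := hS.measurable 1
  set κ : Measure ℝ := volume.restrict (Ioi 0) with hκ
  let h : Ω → ℝ → ℝ := fun ω z => z ^ (a - 1) * Real.exp (-(z * S 1 ω))
  have hinner (z : ℝ) (hz : 0 < z) : ∫ ω, h ω z ∂P = z ^ (a - 1) * Real.exp (-z ^ ν) := by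
    have := hS.laplace 1 z.toNNReal
    simp only [Real.coe_toNNReal z hz.le, NNReal.coe_one, one_mul] at this
    rw [integral_const_mul, this]
  have hgamma := integral_rpow_mul_exp_neg_rpow hν (show -1 < a - 1 by linarith)
  rw [sub_add_cancel] at hgamma
  have hint0 : Integrable (fun z : ℝ => z ^ (a - 1) * Real.exp (-z ^ ν)) κ := by
    refine Integrable.of_integral_ne_zero ?_
    rw [hgamma]
    have := Real.Gamma_pos_of_pos (show 0 < a / ν by positivity)
    positivity
  have hnn (ω : Ω) (z : ℝ) (hz : 0 < z) : ‖h ω z‖ = h ω z := Real.norm_of_nonneg (by positivity)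
  have hint : Integrable (Function.uncurry h) (P.prod κ) := by
    have hm : Measurable (Function.uncurry h) := by
      simp only [h, Function.uncurry_def]
      fun_prop
    rw [integrable_prod_iff' hm.aestronglyMeasurable]
    refine ⟨?_, hint0.congr ?_⟩
    · filter_upwards [ae_restrict_mem measurableSet_Ioi] with z hz
      exact (integrable_exp_neg_mul (P := P) hmeas (mem_Ioi.1 hz).le).const_mul (z ^ (a - 1))
    · filter_upwards [ae_restrict_mem measurableSet_Ioi] with z hz
      rw [← hinner z hz]
      exact integral_congr_ae (ae_of_all _ fun ω => (hnn ω z hz).symm)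
  have houter : (fun ω => ∫ z, h ω z ∂κ) =ᵐ[P] fun ω => (1 / (S 1 ω : ℝ)) ^ a * Real.Gamma a := by
    filter_upwards [hS.ae_pos hν] with ω hω
    rw [← Real.integral_rpow_mul_exp_neg_mul_Ioi ha (NNReal.coe_pos.2 hω)]
    simp only [h, mul_comm]
    rfl
  have hI1 : Integrable (fun ω => (1 / (S 1 ω : ℝ)) ^ a * Real.Gamma a) P :=
    hint.integral_prod_left.congr houter
  refine ⟨(hI1.mul_const (Real.Gamma a)⁻¹).congr (ae_of_all _ fun ω => by
    simp only; field_simp), ?_⟩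
  have hswap := integral_integral_swap hint
  rw [integral_congr_ae houter, integral_mul_const,
    setIntegral_congr_fun measurableSet_Ioi fun z hz => hinner z hz, hgamma] at hswap
  rw [eq_div_iff (by positivity), mul_comm ν, ← mul_assoc, hswap]
  field_simp

theorem IsSubordinator.integral_inv_rpow_mul_natCast (hS : IsSubordinator S (fun x => x ^ ν) P)
    (hν : 0 < ν) (m : ℕ) :
    Integrable (fun ω => (1 / (S 1 ω : ℝ)) ^ (ν * m)) P ∧
      ∫ ω, (1 / (S 1 ω : ℝ)) ^ (ν * m) ∂P = m.factorial / Real.Gamma (ν * m + 1) := by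
  rcases m.eq_zero_or_pos with rfl | hm
  · simp
  have hνm : 0 < ν * m := by positivity
  refine ⟨(hS.integral_inv_rpow hν hνm).1, ?_⟩
  rw [(hS.integral_inv_rpow hν hνm).2, mul_div_cancel_left₀ _ hν.ne', Real.Gamma_add_one hνm.ne',
    ← Real.Gamma_nat_eq_factorial, Real.Gamma_add_one (by positivity)]
  have := Real.Gamma_pos_of_pos hνm
  field_simp

/-- The Laplace transform of the inverse of a stable subordinator: expand the exponential and use
that the `m`-th moment is `m! t^{νm} / Γ(νm + 1)`. -/
theorem IsSubordinator.integral_exp_neg_mul_inverseProcess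
    (hS : IsSubordinator S (fun x => x ^ ν) P) (hν : 0 < ν) (w : ℝ) (t : ℝ≥0) :
    ∫ ω, Real.exp (-(inverseProcess S t ω * w)) ∂P = mittagLeffler ν 1 (-((t : ℝ) ^ ν * w)) := by
  have h1 : (0 : ℝ) < (1 : ℝ) ^ ν := by simp
  have hL := hS.aemeasurable_inverseProcess h1 t
  have hmeas := hS.measurable 1
  have hR : Measurable fun ω => (t / S 1 ω) ^ ν := by fun_prop
  have hterm (m : ℕ) (ω : Ω) : (-(((t / S 1 ω) ^ ν : ℝ≥0) * w)) ^ m / (m.factorial : ℝ) =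
      (-w) ^ m * (t : ℝ) ^ (ν * m) / m.factorial * (1 / (S 1 ω : ℝ)) ^ (ν * m) := by
    push_cast
    rw [neg_mul_eq_mul_neg, mul_pow, ← Real.rpow_mul_natCast (by positivity), div_eq_mul_one_div (t : ℝ),
      Real.mul_rpow (by positivity) (by positivity)]
    ring
  have hI (m : ℕ) := hS.integral_inv_rpow_mul_natCast hν m
  have hsum := hasSum_integral_of_summable_integral_norm (μ := P)
    (F := fun (m : ℕ) ω => (-(((t / S 1 ω) ^ ν : ℝ≥0) * w)) ^ m / (m.factorial : ℝ))
    (fun m => by simp_rw [hterm]; exact (hI m).1.const_mul _) (by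
      refine (summable_fracSeries_bound hν 1 |w| t.coe_nonneg).congr fun m => ?_
      simp_rw [hterm, norm_mul]
      rw [integral_const_mul, integral_congr_ae (ae_of_all _ fun ω =>
        Real.norm_of_nonneg (by positivity : 0 ≤ (1 / (S 1 ω : ℝ)) ^ (ν * m))), (hI m).2,
        norm_div, norm_mul, norm_pow, norm_neg, Real.norm_eq_abs,
        Real.norm_of_nonneg (by positivity : 0 ≤ (t : ℝ) ^ (ν * m)),
        Real.norm_of_nonneg (by positivity : (0 : ℝ) ≤ m.factorial), one_mul]
      field_simp)
  calc ∫ ω, Real.exp (-(inverseProcess S t ω * w)) ∂P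
      = ∫ x : ℝ≥0, Real.exp (-(x * w)) ∂(P.map (inverseProcess S t)) := by
        rw [integral_map hL (by fun_prop)]
    _ = ∫ ω, Real.exp (-(((t / S 1 ω) ^ ν : ℝ≥0) * w)) ∂P := by
        rw [hS.map_inverseProcess hν, integral_map hR.aemeasurable (by fun_prop)]
    _ = ∫ ω, ∑' m : ℕ, (-(((t / S 1 ω) ^ ν : ℝ≥0) * w)) ^ m / (m.factorial : ℝ) ∂P := by
        congr 1 with ω
        rw [Real.exp_eq_exp_ℝ, NormedSpace.exp_eq_tsum_div]
    _ = _ := by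
        rw [mittagLeffler_neg_rpow_mul t.coe_nonneg, fracSeries, ← hsum.tsum_eq]
        refine tsum_congr fun m => ?_
        simp_rw [hterm]
        rw [integral_const_mul, (hI m).2]
        field_simp

end Stable

/-! ### The law of the time-changed Poisson process -/

section TimeChange

variable {Ω : Type*} [MeasurableSpace Ω] {P : Measure Ω}

theorem IsPoissonProcess.integral_pow {N : ℝ≥0 → Ω → ℕ} {lam : ℝ≥0}
    (hN : IsPoissonProcess N lam P) (s : ℝ≥0) (u : ℝ) :
    ∫ ω, u ^ N s ω ∂P = Real.exp (-(lam * (1 - u) * s)) := by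
  have hmap : P.map (N s) = poissonMeasure (lam * s) := by
    rw [← hN.law 0 s, zero_add]
    refine Measure.map_congr ?_
    filter_upwards [hN.zero] with ω hω
    rw [hω, Nat.sub_zero]
  rw [← integral_map (f := fun k : ℕ => u ^ k) (hN.measurable s).aemeasurable
    measurable_from_nat.aestronglyMeasurable, hmap, integral_poissonMeasure]
  have h := (NormedSpace.expSeries_div_hasSum_exp ((lam * s : ℝ) * u)).mul_left
    (Real.exp (-(lam * s)))
  rw [← Real.exp_eq_exp_ℝ, ← Real.exp_add] at h
  rw [show -(lam * (1 - u) * s : ℝ) = -(lam * s) + lam * s * u by ring, ← h.tsum_eq]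
  refine tsum_congr fun k => ?_
  rw [mul_pow _ u, smul_eq_mul]
  push_cast
  ring

theorem integral_exp_neg_mul_sum {n : ℕ} {f : Fin n → BernsteinFn} {H : Fin n → ℝ≥0 → Ω → ℝ≥0}
    (hH : ∀ j, IsSubordinator (H j) (f j).eval P)
    (hind : iIndepFun (fun j ω (t : ℝ≥0) => H j t ω) P) (s : ℝ≥0) {z : ℝ} (hz : 0 ≤ z) :
    ∫ ω, Real.exp (-(z * (∑ j, H j s ω : ℝ≥0))) ∂P =
      Real.exp (-(s * ∑ j, (f j).eval z)) := by
  have h1 := (hind.comp (fun _ x => x s) fun _ => measurable_pi_apply s).integral_fun_prod_comp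
    (f := fun _ x => Real.exp (-(z * (x : ℝ≥0)))) (fun j => ((hH j).measurable s).aemeasurable)
    (fun j => by fun_prop)
  have h2 (j : Fin n) : ∫ ω, Real.exp (-(z * H j s ω)) ∂P = Real.exp (-(s * (f j).eval z)) := by
    have := (hH j).laplace s z.toNNReal
    rwa [Real.coe_toNNReal z hz] at this
  simp only [Function.comp_def, h2] at h1
  rw [Finset.mul_sum, ← Finset.sum_neg_distrib, Real.exp_sum, ← h1]
  congr 1 with ω
  rw [← Real.exp_sum, Finset.sum_neg_distrib, ← Finset.mul_sum]
  push_cast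
  rfl

theorem hasSum_measureReal_mul_pow [IsProbabilityMeasure P] {X : Ω → ℕ} (hX : AEMeasurable X P)
    {u : ℝ} (hu : |u| ≤ 1) :
    HasSum (fun k => P.real {ω | X ω = k} * u ^ k) (∫ ω, u ^ X ω ∂P) := by
  have := Measure.isProbabilityMeasure_map (μ := P) hX
  have hint : Integrable (fun k : ℕ => u ^ k) (P.map X) :=
    Integrable.of_bound measurable_from_nat.aestronglyMeasurable 1 (ae_of_all _ fun k => by
      rw [norm_pow]
      exact pow_le_one₀ (norm_nonneg _) hu)
  have h := hasSum_integral_iUnion (μ := P.map X) (s := fun k : ℕ => {k})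
    (f := fun k : ℕ => u ^ k) (fun k => measurableSet_singleton k)
    (fun i j hij => by simpa using hij) hint.integrableOn
  rw [iUnion_of_singleton, setIntegral_univ, integral_map hX
    measurable_from_nat.aestronglyMeasurable] at h
  refine h.congr_fun fun k => ?_
  rw [integral_singleton, smul_eq_mul, map_measureReal_apply_of_aemeasurable hX
    (measurableSet_singleton k)]
  rfl

variable {n : ℕ} {f : Fin n → BernsteinFn} {lam : ℝ≥0} {ν : ℝ}
  {N : ℝ≥0 → Ω → ℕ} {H : Fin n → ℝ≥0 → Ω → ℝ≥0} {S : ℝ≥0 → Ω → ℝ≥0}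

theorem measurable_optionElim_path (hH : ∀ j, IsSubordinator (H j) (f j).eval P)
    (hS : IsSubordinator S (fun x => x ^ ν) P) (i : Option (Fin n)) :
    Measurable fun ω (t : ℝ≥0) => i.elim S H t ω := by
  refine measurable_pi_lambda _ fun t => ?_
  rcases i with _ | j
  · exact hS.measurable t
  · exact (hH j).measurable t

variable [IsProbabilityMeasure P]

/-- Grid approximations of `inverseProcess S t` from the right, where the `H j` are right-continuous,
exhibit the time change as an almost sure limit of measurable functionals of the paths of `S` and
the `H j`. -/
theorem indepFun_apply_timeChange (hH : ∀ j, IsSubordinator (H j) (f j).eval P)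
    (hS : IsSubordinator S (fun x => x ^ ν) P)
    (hNSH : IndepFun (fun ω (t : ℝ≥0) => N t ω)
      (fun ω (i : Option (Fin n)) (t : ℝ≥0) => i.elim S H t ω) P) (t s : ℝ≥0) :
    IndepFun (N s) (fun ω => ∑ j, H j (inverseProcess S t ω) ω) P ∧
      AEMeasurable (fun ω => ∑ j, H j (inverseProcess S t ω) ω) P := by
  refine indepFun_and_aemeasurable_of_tendsto
    (Z := fun ω (i : Option (Fin n)) (t : ℝ≥0) => i.elim S H t ω)
    (measurable_pi_lambda _ (measurable_optionElim_path hH hS))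
    (hNSH.comp (measurable_pi_apply s) measurable_id)
    (g := fun n z => ∑ j, z (some j) ((hitIndex n t (z none) : ℝ≥0) / (n + 1))) (fun n => ?_) ?_
  · refine Finset.measurable_sum _ fun j _ => ?_
    exact measurable_apply_comp_nat (Y := fun s (z : Option (Fin _) → ℝ≥0 → ℝ≥0) => z (some j) s)
      (fun s => (measurable_pi_apply s).comp (measurable_pi_apply _))
      (fun k => (k : ℝ≥0) / (n + 1)) ((measurable_hitIndex n t).comp (measurable_pi_apply none))
  · filter_upwards [hS.tendsto_inverseProcess (by simp), ae_all_iff.2 fun j => (hH j).rightCont]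
      with ω hω hrc
    exact tendsto_finsetSum _ fun j _ => (hrc j _).tendsto.comp (hω t)

theorem indepFun_sum_inverseProcess (hH : ∀ j, IsSubordinator (H j) (f j).eval P)
    (hS : IsSubordinator S (fun x => x ^ ν) P)
    (hSH : iIndepFun (fun (i : Option (Fin n)) ω (t : ℝ≥0) => i.elim S H t ω) P) (t s : ℝ≥0) :
    IndepFun (fun ω => ∑ j, H j s ω) (inverseProcess S t) P := by
  have hpath := measurable_optionElim_path hH hS
  have h1 := hSH.indepFun_finset (Finset.univ.erase none) {none}
    (by simp [Finset.disjoint_left]) hpath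
  have h2 : IndepFun (fun ω => ∑ j, H j s ω) (fun ω (t : ℝ≥0) => S t ω) P := by
    refine h1.comp
      (φ := fun z => ∑ j : Fin n, z ⟨some j, by simp⟩ s)
      (ψ := fun z => z ⟨none, by simp⟩) ?_ ?_
    swap
    · exact measurable_pi_apply (⟨none, by simp⟩ : ({none} : Finset (Option (Fin n))))
    exact Finset.measurable_sum _ fun j _ => (measurable_pi_apply s).comp (measurable_pi_apply _)
  refine (indepFun_and_aemeasurable_of_tendsto (hpath none) h2
    (g := fun n x => (hitIndex n t x : ℝ≥0) / (n + 1)) (fun n => ?_) ?_).1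
  · exact (measurable_from_nat (f := fun k : ℕ => (k : ℝ≥0) / (n + 1))).comp (measurable_hitIndex n t)
  · filter_upwards [hS.tendsto_inverseProcess (by simp)] with ω hω
    exact tendsto_nhds_of_tendsto_nhdsWithin (hω t)

theorem integral_exp_neg_mul_timeChange (hν : 0 < ν)
    (hH : ∀ j, IsSubordinator (H j) (f j).eval P) (hS : IsSubordinator S (fun x => x ^ ν) P)
    (hSH : iIndepFun (fun (i : Option (Fin n)) ω (t : ℝ≥0) => i.elim S H t ω) P) (t : ℝ≥0) {z : ℝ}
    (hz : 0 ≤ z) :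
    ∫ ω, Real.exp (-(z * (∑ j, H j (inverseProcess S t ω) ω : ℝ≥0))) ∂P =
      mittagLeffler ν 1 (-((t : ℝ) ^ ν * ∑ j, (f j).eval z)) := by
  have hrc : ∀ᵐ ω ∂P, ∀ t, ContinuousWithinAt (fun s => ∑ j, H j s ω) (Ici t) t := by
    filter_upwards [ae_all_iff.2 fun j => (hH j).rightCont] with ω hω t
    exact tendsto_finsetSum _ fun j _ => (hω j t).tendsto
  have h := integral_apply_comp (P := P) (Y := fun s ω => ∑ j, H j s ω)
    (fun s => Finset.measurable_sum _ fun j _ => (hH j).measurable s) hrc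
    (hS.aemeasurable_inverseProcess (by simp) t) (indepFun_sum_inverseProcess hH hS hSH t)
    (φ := fun x : ℝ≥0 => Real.exp (-(z * x))) (by fun_prop) (M := 1) fun x => by
      rw [Real.norm_of_nonneg (Real.exp_pos _).le]
      exact Real.exp_le_one_iff.2 (neg_nonpos.2 (by positivity))
  rw [h, ← hS.integral_exp_neg_mul_inverseProcess hν]
  congr 1 with ω
  exact integral_exp_neg_mul_sum hH (hSH.precomp (Option.some_injective _)) _ hz

theorem aemeasurable_timeChanged (hN : IsPoissonProcess N lam P)
    (hH : ∀ j, IsSubordinator (H j) (f j).eval P) (hS : IsSubordinator S (fun x => x ^ ν) P)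
    (hNSH : IndepFun (fun ω (t : ℝ≥0) => N t ω)
      (fun ω (i : Option (Fin n)) (t : ℝ≥0) => i.elim S H t ω) P) (t : ℝ≥0) :
    AEMeasurable (timeChanged N H S t) P :=
  aemeasurable_apply_comp hN.measurable hN.rightCont
    (indepFun_apply_timeChange hH hS hNSH t 0).2

theorem integral_pow_timeChanged (hν : 0 < ν) (hN : IsPoissonProcess N lam P)
    (hH : ∀ j, IsSubordinator (H j) (f j).eval P) (hS : IsSubordinator S (fun x => x ^ ν) P)
    (hSH : iIndepFun (fun (i : Option (Fin n)) ω (t : ℝ≥0) => i.elim S H t ω) P)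
    (hNSH : IndepFun (fun ω (t : ℝ≥0) => N t ω)
      (fun ω (i : Option (Fin n)) (t : ℝ≥0) => i.elim S H t ω) P) (t : ℝ≥0) {u : ℝ}
    (hu : |u| ≤ 1) :
    ∫ ω, u ^ timeChanged N H S t ω ∂P =
      mittagLeffler ν 1 (-((t : ℝ) ^ ν * ∑ j, (f j).eval (lam * (1 - u)))) := by
  have h := integral_apply_comp (P := P) (Y := N) hN.measurable hN.rightCont
    (indepFun_apply_timeChange hH hS hNSH t 0).2
    (fun s => (indepFun_apply_timeChange hH hS hNSH t s).1)
    (φ := fun k : ℕ => u ^ k) continuous_of_discreteTopology (M := 1) fun k => by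
      rw [norm_pow]
      exact pow_le_one₀ (norm_nonneg _) hu
  have h1 : 0 ≤ 1 - u := sub_nonneg.2 (abs_le.1 hu).2
  rw [← integral_exp_neg_mul_timeChange hν hH hS hSH t (by positivity : 0 ≤ (lam : ℝ) * (1 - u))]
  refine h.trans ?_
  simp_rw [hN.integral_pow]

theorem stateProb_eq_toeplitzSolution (hν : 0 < ν) (hN : IsPoissonProcess N lam P)
    (hH : ∀ j, IsSubordinator (H j) (f j).eval P) (hS : IsSubordinator S (fun x => x ^ ν) P)
    (hSH : iIndepFun (fun (i : Option (Fin n)) ω (t : ℝ≥0) => i.elim S H t ω) P)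
    (hNSH : IndepFun (fun ω (t : ℝ≥0) => N t ω)
      (fun ω (i : Option (Fin n)) (t : ℝ≥0) => i.elim S H t ω) P) (k : ℕ) {t : ℝ} (ht : 0 ≤ t) :
    stateProb (timeChanged N H S) P k t =
      toeplitzSolution ν (fun i => ∑ j, (f j).shiftCoeff lam i) k t := by
  have ha := summable_abs_sum_shiftCoeff Finset.univ f lam.coe_nonneg
  refine congrFun (eq_of_hasSum_mul_pow (x := fun k => stateProb (timeChanged N H S) P k t)
    (y := fun k => toeplitzSolution ν (fun i => ∑ j, (f j).shiftCoeff lam i) k t)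
    (fun u hu => hasSum_measureReal_mul_pow
      (aemeasurable_timeChanged hN hH hS hNSH t.toNNReal) hu) fun u hu => ?_) k
  rw [integral_pow_timeChanged hν hN hH hS hSH hNSH _ hu, Real.coe_toNNReal t ht]
  refine hasSum_toeplitzSolution_mul_pow hν ha hu ?_ ht
  simp_rw [Finset.sum_mul]
  exact hasSum_sum fun j _ => (f j).hasSum_shiftCoeff_mul_pow lam.coe_nonneg hu

end TimeChange

theorem theorem4p2 {Ω : Type*} [MeasurableSpace Ω] (P : Measure Ω) [IsProbabilityMeasure P]
    (n : ℕ) (f : Fin n → BernsteinFn) (lam : ℝ≥0) (hlam : 0 < lam)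
    (ν : ℝ) (hν : ν ∈ Ioo (0 : ℝ) 1)
    (N : ℝ≥0 → Ω → ℕ) (H : Fin n → ℝ≥0 → Ω → ℝ≥0) (S : ℝ≥0 → Ω → ℝ≥0)
    (hN : IsPoissonProcess N lam P)
    (hH : ∀ j, IsSubordinator (H j) (f j).eval P)
    (hS : IsSubordinator S (fun x => x ^ ν) P)
    -- the processes `S`, `H 1`, ..., `H n` are independent of each other, and jointly of `N`
    (hSH : iIndepFun (fun (i : Option (Fin n)) ω (t : ℝ≥0) => i.elim S H t ω) P)
    (hNSH : IndepFun (fun ω (t : ℝ≥0) => N t ω)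
      (fun ω (i : Option (Fin n)) (t : ℝ≥0) => i.elim S H t ω) P) :
    (∀ t, AEMeasurable (timeChanged N H S t) P) ∧
    IsFractionalCauchySolution ν lam f (stateProb (timeChanged N H S) P) ∧
    (∀ q : ℕ → ℝ → ℝ, IsFractionalCauchySolution ν lam f q →
      ∀ k, ∀ t, 0 ≤ t → q k t = stateProb (timeChanged N H S) P k t) ∧
    (∀ t : ℝ≥0, ∀ u : ℝ, |u| ≤ 1 →
      ∫ ω, u ^ timeChanged N H S t ω ∂P =
        mittagLeffler ν 1 (-((t : ℝ) ^ ν * ∑ j, (f j).eval (lam * (1 - u))))) := by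
  have hp (k : ℕ) {t : ℝ} (ht : 0 ≤ t) :=
    stateProb_eq_toeplitzSolution hν.1 hN hH hS hSH hNSH k ht
  set a : ℕ → ℝ := fun i => ∑ j, (f j).shiftCoeff lam i
  have ha : Summable fun i => |a i| := summable_abs_sum_shiftCoeff Finset.univ f lam.coe_nonneg
  have hop (q : ℕ → ℝ) (k : ℕ) : ∑ j, (f j).shiftOp lam q k = toeplitz a q k := by
    simp_rw [(f _).shiftOp_eq_toeplitz lam.coe_nonneg]
    exact sum_toeplitz _ _ _ _
  have hsol : IsFractionalCauchySolution ν lam f (stateProb (timeChanged N H S) P) := by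
    refine ⟨fun k => by rw [hp k le_rfl, toeplitzSolution_zero hν.1], fun k t ht => ?_⟩
    simp_rw [hop, hp _ ht.le]
    exact (hasCaputoDerivAt_toeplitzSolution hν ha k ht).congr (fun s hs => hp k hs.1) ht
  refine ⟨aemeasurable_timeChanged hN hH hS hNSH, hsol, fun q hq k t ht => ?_,
    fun t u hu => integral_pow_timeChanged hν.1 hN hH hS hSH hNSH t hu⟩
  refine eq_of_hasCaputoDerivAt_toeplitz (a := a) hν (fun k => by rw [hq.init, hsol.init])
    (fun k t ht => ?_) (fun k t ht => ?_) k ht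
  · rw [← hop]
    exact hq.equation k t ht
  · rw [← hop]
    exact hsol.equation k t ht
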